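/- Let $m\ge 0$, let $[m]=\{1,\dots,m\}$, and let $X=(x_{ij})$ be an $m\times m$ matrix of indeterminates over $\mathbb C$, with rows numbered from bottom to top. For $I\subseteq[m]$ let $x_I\in\mathbb C[x_{ij}]$ be the minor of $X$ with row set $\{1,\dots,|I|\}$ and column set $I$ (so $x_\emptyset=1$). Let $S$ be any set of lattice points $(m-a,a)$, $0\le a\le m$ (the selected sinks), and let $L$ be the partial staircase they define, i.e. the set of points $v\in\mathbb Z_{\ge0}^2$ with $v\le s$ coordinatewise for some $s\in S$. For $I\subseteq[m]$ let $p(I)$ be the lattice path starting at $(0,0)$ whose $i$-th step goes north if $i\in I$ and east if $i\notin I$ ($1\le i\le m$). Say that $I$ fits in $L$ if all nodes of $p(I)$ lie in $L$. Call pairs $u<v$ and $x<y$ in $[m]\cup\{\infty\}$ non-crossing if neither $x<u<y<v$ nor $u<x<v<y$ holds. Let $I=\{i_1<\dots<i_k\}$ and $J=\{j_1<\dots<j_l\}$ with $k\le l$. Delete $i_s$ and $j_s$ whenever $i_s=j_s$, leaving $i'_1<\dots<i'_{k'}$ and $j'_1<\dots<j'_{l'}$. Then $I$ and $J$ are non-crossing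 if $\{i'_s,i'_{s+1}\}$ and $\{j'_s,j'_{s+1}\}$ are non-crossing for all $1\le s\le k'-1$ and, in case $1\le k'<l'$, also $\{i'_{k'},\infty\}$ and $\{j'_{k'},j'_{k'+1}\}$ are non-crossing. Let $\mathbf m_L^{(nc)}$ be the simplicial complex whose faces are the sets of pairwise non-crossing subsets of $[m]$ that fit in $L$. Let $R_L\subseteq\mathbb C[x_{ij}]$ be the subalgebra generated by the $x_I$ with $I$ fitting in $L$. Let $A_L=\mathbb C[y_I : \emptyset\ne I\subseteq[m],\ I\text{ fits in }L]$, and let $J_L$ be the kernel of the surjection $A_L\to R_L$, $y_I\mapsto x_I$. Then there is a term order on the monomials of $A_L$ such that: 1. a monomial $\prod_I y_I^{e_I}$ is standard (that is, does not lie in the initial ideal of $J_L$) if and only if it is a non-crossing-tableau monomial, i.e. $\{I : e_I>0\}$ is a face of $\mathbf m_L^{(nc)}$; 2. the initial ideal of $J_L$ is generated by squarefree monomials. Moreover, the products $\prod_I x_I^{e_I}$, taken over all exponent vectors $(e_I)$ for which $\{I : e_I>0\}$ is a face of $\mathbf m_L^{(nc)}$, form a $\mathbb C$-basis of $R_L$.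 -/

import Mathlib

namespace NonCrossingTableaux

/-! ### The non-crossing rule on subsets of `[m]`

The ground set `[m] = {1, …, m}` is modelled by `Fin m`, with its order. -/

/-- Two pairs `{u < v}` and `{x < y}` are non-crossing when neither `x < u < y < v` nor
`u < x < v < y` holds. -/
def NonCrossingPairs {α : Type*} [LT α] (u v x y : α) : Prop :=
  ¬ (x < u ∧ u < y ∧ y < v) ∧ ¬ (u < x ∧ x < v ∧ v < y)

/-- Removal of the common part of two sequences: whenever the entries in the same position
agree, both are removed. -/
def removeCommon {α : Type*} [DecidableEq α] : List α → List α → List α × List α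
  | i :: is, j :: js =>
    if i = j then removeCommon is js
    else (i :: (removeCommon is js).1, j :: (removeCommon is js).2)
  | is, js => (is, js)

/-- The elements of `I` in increasing order, regarded in `[m] ∪ {∞}`. -/
def increasingList {m : ℕ} (I : Finset (Fin m)) : List (WithTop (Fin m)) :=
  (I.sort (· ≤ ·)).map (fun i : Fin m => (i : WithTop (Fin m)))

/-- The two conditions of the non-crossing rule, for sequences `I'` and `J'` (with `I'` not
longer than `J'`) whose common part has been removed.  Positions are counted from `0`. -/
def NonCrossingLists {α : Type*} [LT α] [Top α] (I' J' : List α) : Prop :=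
  (∀ (s : ℕ) (u v x y : α), I'[s]? = some u → I'[s + 1]? = some v →
    J'[s]? = some x → J'[s + 1]? = some y → NonCrossingPairs u v x y) ∧
  (∀ (s : ℕ) (u x y : α), s + 1 = I'.length → I'[s]? = some u →
    J'[s]? = some x → J'[s + 1]? = some y → NonCrossingPairs u ⊤ x y)

/-- The non-crossing rule for `I`, `J` with `|I| ≤ |J|`. -/
def NonCrossingOfLE {m : ℕ} (I J : Finset (Fin m)) : Prop :=
  NonCrossingLists (removeCommon (increasingList I) (increasingList J)).1
    (removeCommon (increasingList I) (increasingList J)).2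

/-- Subsets `I` and `J` of `[m]` are non-crossing (the smaller of the two is put first; for
sets of equal size the rule is symmetric). -/
def NonCrossing {m : ℕ} (I J : Finset (Fin m)) : Prop :=
  if I.card ≤ J.card then NonCrossingOfLE I J else NonCrossingOfLE J I

/-! ### Partial staircases and the non-crossing complex -/

/-- The sinks of the staircase `L_m`: the lattice points `(m - a, a)` with `0 ≤ a ≤ m`. -/
def staircaseSinks (m : ℕ) : Set (ℕ × ℕ) := {v | v.1 + v.2 = m}

/-- The nodes of the partial staircase with selected sinks `S`: all lattice points
(weakly) to the south and west of a selected sink. -/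
def partialStaircase (S : Set (ℕ × ℕ)) : Set (ℕ × ℕ) := {v | ∃ s ∈ S, v ≤ s}

/-- The node reached after `t` steps by the lattice path `p(I)`, which starts at `(0, 0)` and
whose step number `i` goes north if `i ∈ I` and east otherwise. -/
def pathNode {m : ℕ} (I : Finset (Fin m)) (t : ℕ) : ℕ × ℕ :=
  ((Finset.univ.filter (fun i : Fin m => (i : ℕ) < t ∧ i ∉ I)).card,
   (Finset.univ.filter (fun i : Fin m => (i : ℕ) < t ∧ i ∈ I)).card)

/-- The path `p(I)` fits inside the set of nodes `L`. -/
def PathFits {m : ℕ} (L : Set (ℕ × ℕ)) (I : Finset (Fin m)) : Prop :=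
  ∀ t ≤ m, pathNode I t ∈ L

/-- The faces of the non-crossing compatibility complex of `L`: finite sets of subsets of `[m]`
whose paths fit inside `L` and which are pairwise non-crossing. -/
def ncComplex (m : ℕ) (L : Set (ℕ × ℕ)) : Set (Finset (Finset (Fin m))) :=
  {F | (∀ I ∈ F, PathFits L I) ∧ ∀ I ∈ F, ∀ J ∈ F, NonCrossing I J}

/-! ### The Plücker algebra and its presentation -/

/-- The Plücker coordinate `x_I`: the minor of the generic `m × m` matrix with column set `I`
and with the `|I|` bottom rows as row set.  The rows of the matrix are numbered from bottom
to top. -/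
noncomputable def pluckerCoord {m : ℕ} (I : Finset (Fin m)) :
    MvPolynomial (Fin m × Fin m) ℂ :=
  ((Matrix.mvPolynomialX (Fin m) (Fin m) ℂ).submatrix
    (Fin.castLE (card_finset_fin_le I)) (I.orderEmbOfFin rfl)).det

/-- The subalgebra of the Plücker algebra generated by the `x_I` whose path fits inside `L`. -/
noncomputable def pluckerAlgebra (m : ℕ) (L : Set (ℕ × ℕ)) :
    Subalgebra ℂ (MvPolynomial (Fin m × Fin m) ℂ) :=
  Algebra.adjoin ℂ {f | ∃ I : Finset (Fin m), PathFits L I ∧ pluckerCoord I = f}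

/-- The index set of the variables `y_I` of the presentation: the non-empty `I ⊆ [m]` whose path
fits inside `L`.  (The coordinate `x_∅` is the constant `1` and not a generator.) -/
abbrev PluckerIndex (m : ℕ) (L : Set (ℕ × ℕ)) : Type :=
  {I : Finset (Fin m) // I.Nonempty ∧ PathFits L I}

/-- The presentation `y_I ↦ x_I`, whose image is the Plücker algebra of `L`. -/
noncomputable def pluckerPresentation (m : ℕ) (L : Set (ℕ × ℕ)) :
    MvPolynomial (PluckerIndex m L) ℂ →ₐ[ℂ] MvPolynomial (Fin m × Fin m) ℂ :=
  MvPolynomial.aeval (fun I => pluckerCoord I.1)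

/-- The ideal of all polynomial relations among the Plücker coordinates of `L`. -/
noncomputable def pluckerIdeal (m : ℕ) (L : Set (ℕ × ℕ)) :
    Ideal (MvPolynomial (PluckerIndex m L) ℂ) :=
  RingHom.ker (pluckerPresentation m L)

/-- The multiset of columns with exponent vector `e` (in which the set `I` occurs `e I` times) is
a non-crossing tableau: it is supported on a face of the non-crossing complex. -/
def IsNCTableau {m : ℕ} {L : Set (ℕ × ℕ)} (e : PluckerIndex m L →₀ ℕ) : Prop :=
  e.support.map (Function.Embedding.subtype _) ∈ ncComplex m L

/-! ### Initial ideals and standard monomials -/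

/-- The initial ideal of `J`: it is generated by the leading monomials of the non-zero
elements of `J`. -/
noncomputable def initialIdeal {σ : Type*} (ord : MonomialOrder σ) (J : Ideal (MvPolynomial σ ℂ)) :
    Ideal (MvPolynomial σ ℂ) :=
  Ideal.span {g | ∃ f ∈ J, f ≠ 0 ∧ MvPolynomial.monomial (ord.degree f) 1 = g}

/-- The monomial with exponent vector `e` is standard: it is not in the initial ideal. -/
def IsStandardMonomial {σ : Type*} (ord : MonomialOrder σ) (J : Ideal (MvPolynomial σ ℂ))
    (e : σ →₀ ℕ) : Prop :=
  MvPolynomial.monomial e (1 : ℂ) ∉ initialIdeal ord J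

/-- An ideal generated by squarefree monomials. -/
def IsSquarefreeMonomialIdeal {σ : Type*} (J : Ideal (MvPolynomial σ ℂ)) : Prop :=
  ∃ E : Set (σ →₀ ℕ), (∀ e ∈ E, ∀ i, e i ≤ 1) ∧
    J = Ideal.span ((fun e => MvPolynomial.monomial e (1 : ℂ)) '' E)

end NonCrossingTableaux

/-!
# Non-crossing standard monomials for partial flag minors

The path of `I` fits in a partial staircase exactly when its endpoint `(m - |I|, |I|)` lies in the
staircase, so fitting is a condition on the size of `I` only (`PathFits.of_card_eq`).

For the diagonal order on monomials in the matrix entries, the leading term of `x_I` is the product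
of its diagonal entries, so the leading exponent of a product of minors records the contents of the
rows of the tableau formed by the columns `I`. The theorem rests on three facts about tableaux with
the same row contents.

* A non-crossing tableau is determined by its row contents
  (`eq_of_nonCrossing_of_rowCount_eq`): its columns are built up row by row, and the non-crossing
  rule leaves only one way to distribute the entries of the next row over the columns. In
  particular non-crossing tableau monomials have distinct leading terms, hence are linearly
  independent.
* If two columns of a tableau cross, they may exchange their tails
  (`CrossAt.exists_uncrossing`). This preserves the row contents, and lowers the sequence of
  weights `∑ a, I a * I (a + d)`, `d = 0, 1, …`, lexicographically (`CrossAt.colWeight_lt`).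
* The difference of two products of two minors with the same leading term is a combination of
  products of two minors of the same sizes with smaller leading terms
  (`pluckerCoord_mul_sub_mem_span`). Indeed, by the Garnir relations the products of two minors
  are spanned by the semistandard ones, and these have distinct leading terms.

The term order compares leading exponents in the diagonal order first and the weights afterwards.
By the last two facts every monomial with a crossing is the leading monomial of a relation, and
reducing by these relations shows that the non-crossing tableau monomials span. Being independent,
they contain no leading monomial of a relation. The initial ideal is squarefree because being
non-crossing depends only on the support of an exponent vector.
-/

namespace NonCrossingTableaux

/-! ### Monomial orders -/

/-- The order on exponents over `σ` which compares the images under an additive map `Φ` by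
`ord₁`, and breaks ties by `ord₂`. -/
noncomputable def refineOrder {σ τ : Type} (Φ : (σ →₀ ℕ) →+ (τ →₀ ℕ))
    (ord₁ : MonomialOrder.{0, 0} τ) (ord₂ : MonomialOrder.{0, 0} σ) : MonomialOrder.{0, 0} σ :=
  let key : (σ →₀ ℕ) → ord₁.syn ×ₗ ord₂.syn := fun e => toLex (ord₁.toSyn (Φ e), ord₂.toSyn e)
  have key_inj : Function.Injective key := fun e e' h => by
    simpa [key] using congrArg (fun p => (ofLex p).2) h
  letI lo : LinearOrder (σ →₀ ℕ) := LinearOrder.lift' key key_inj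
  { syn := σ →₀ ℕ
    addCommMonoidSyn := inferInstance
    linearOrderSyn := lo
    isOrderedAddMonoid_syn := by
      refine @IsOrderedAddMonoid.mk _ _ lo.toPreorder (fun a b h c => ?_) (fun a b h c => ?_)
      · change key _ ≤ key _
        change key a ≤ key b at h
        simp only [key, Prod.Lex.toLex_le_toLex, map_add] at h ⊢
        simpa using h
      · change key _ ≤ key _
        change key a ≤ key b at h
        simp only [key, Prod.Lex.toLex_le_toLex, map_add] at h ⊢
        simpa using h
    toSyn := AddEquiv.refl _
    toSyn_monotone := fun a b h => by
      change key _ ≤ key _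
      obtain ⟨c, rfl⟩ := le_iff_exists_add.mp h
      simp only [key, Prod.Lex.toLex_le_toLex, map_add, AddEquiv.refl_apply]
      rcases (ord₁.le_add_right (Φ a) (Φ c)).lt_or_eq with h | h
      · exact Or.inl h
      · exact Or.inr ⟨h, ord₂.le_add_right a c⟩
    wellFoundedLT_syn := ⟨InvImage.wf key wellFounded_lt⟩ }

theorem refineOrder_lt_iff {σ τ : Type} (Φ : (σ →₀ ℕ) →+ (τ →₀ ℕ))
    (ord₁ : MonomialOrder.{0, 0} τ) (ord₂ : MonomialOrder.{0, 0} σ) (e e' : σ →₀ ℕ) :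
    (refineOrder Φ ord₁ ord₂).toSyn e < (refineOrder Φ ord₁ ord₂).toSyn e' ↔
      ord₁.toSyn (Φ e) < ord₁.toSyn (Φ e') ∨
        Φ e = Φ e' ∧ ord₂.toSyn e < ord₂.toSyn e' := by
  change toLex (ord₁.toSyn (Φ e), ord₂.toSyn e) < toLex (ord₁.toSyn (Φ e'), ord₂.toSyn e') ↔ _
  simp [Prod.Lex.toLex_lt_toLex]

/-- The diagonal order on monomials in the entries of a matrix: lexicographic, the entries being
read row by row, from left to right. -/
noncomputable def diagonalOrder (m : ℕ) : MonomialOrder.{0, 0} (Fin m × Fin m) where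
  syn := Lex ((Fin m ×ₗ Fin m) →₀ ℕ)
  toSyn := (Finsupp.domCongr toLex).trans (toLexAddEquiv _)
  toSyn_monotone := fun a b h => Finsupp.toLex_monotone fun i => h (ofLex i)

theorem diagonalOrder_lt_of {m : ℕ} {a b : Fin m × Fin m →₀ ℕ} (i j : Fin m)
    (hrow : ∀ i' < i, ∀ j', a (i', j') = b (i', j')) (hcol : ∀ j' < j, a (i, j') = b (i, j'))
    (h : a (i, j) < b (i, j)) : (diagonalOrder m).toSyn a < (diagonalOrder m).toSyn b := by
  refine ⟨toLex (i, j), ?_, h⟩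
  intro p hp
  obtain ⟨⟨i', j'⟩, rfl⟩ := toLex.surjective p
  rcases Prod.Lex.toLex_lt_toLex.mp hp with h1 | ⟨h1, h2⟩
  · exact hrow i' h1 j'
  · obtain rfl : i' = i := h1
    exact hcol j' h2

/-- Among polynomials with pairwise distinct leading exponents no cancellation of leading terms
takes place. -/
theorem degree_le_degree_linearCombination {σ ι : Type*} (ord : MonomialOrder σ)
    (g : ι → MvPolynomial σ ℂ) (hg : ∀ i, g i ≠ 0)
    (c : ι →₀ ℂ) (hinj : Set.InjOn (fun i => ord.degree (g i)) c.support) {i : ι} (hi : c i ≠ 0) :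
    Finsupp.linearCombination ℂ g c ≠ 0 ∧
    ord.toSyn (ord.degree (g i)) ≤ ord.toSyn (ord.degree (Finsupp.linearCombination ℂ g c)) := by
  obtain ⟨p, hp, hmax⟩ := c.support.exists_max_image (fun i => ord.toSyn (ord.degree (g i)))
    ⟨i, by simpa using hi⟩
  have hcoeff : (Finsupp.linearCombination ℂ g c).coeff (ord.degree (g p)) ≠ 0 := by
    rw [Finsupp.linearCombination_apply, Finsupp.sum, MvPolynomial.coeff_sum,
      Finset.sum_eq_single_of_mem p hp]
    · rw [MvPolynomial.coeff_smul, smul_eq_mul]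
      exact mul_ne_zero (by simpa using hp) (by simpa using hg p)
    · intro q hq hqp
      rw [MvPolynomial.coeff_smul, ord.coeff_eq_zero_of_lt, smul_zero]
      refine lt_of_le_of_ne (hmax q hq) fun h => hqp (hinj hq hp ?_)
      exact ord.toSyn.injective h
  refine ⟨fun h => hcoeff (by rw [h, MvPolynomial.coeff_zero]),
    (hmax i (by simpa using hi)).trans ?_⟩
  exact ord.le_degree (MvPolynomial.mem_support_iff.mpr hcoeff)

theorem linearIndependent_of_degree_injective {σ ι : Type*} (ord : MonomialOrder σ)
    (g : ι → MvPolynomial σ ℂ) (hg : ∀ i, g i ≠ 0)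
    (hinj : Function.Injective (fun i => ord.degree (g i))) : LinearIndependent ℂ g := by
  rw [linearIndependent_iff]
  intro c hc
  ext i
  by_contra hi
  exact (degree_le_degree_linearCombination ord g hg c hinj.injOn hi).1 hc

/-! ### The non-crossing rule in terms of columns continued by `∞` -/

theorem length_removeCommon_le {α : Type*} [DecidableEq α] :
    ∀ (l₁ l₂ : List α), l₁.length ≤ l₂.length →
    (removeCommon l₁ l₂).1.length ≤ (removeCommon l₁ l₂).2.length
  | [], _, _ => by simp [removeCommon]
  | _ :: _, [], h => by simp at h
  | i :: is, j :: js, h => by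
    have ih := length_removeCommon_le is js (by simpa using h)
    rw [removeCommon]
    split_ifs
    · exact ih
    · simpa using ih

theorem nonCrossingPairs_of_eq {α : Type*} [Preorder α] {u v x y : α} (h : v = y) :
    NonCrossingPairs u v x y := by
  subst h
  exact ⟨fun h => lt_irrefl _ h.2.2, fun h => lt_irrefl _ h.2.2⟩

section Lists

variable {α : Type*} [LinearOrder α] [OrderTop α]

/-- The condition that `NonCrossingLists (i :: I') (j :: J')` imposes on the leading entries
`i` and `j`. -/
def HeadNonCrossing (i j : α) (I' J' : List α) : Prop :=
  ∀ y, J'[0]? = some y → NonCrossingPairs i (I'[0]?.getD ⊤) j y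

theorem nonCrossingLists_cons (i j : α) (I' J' : List α) (hlen : I'.length ≤ J'.length) :
    NonCrossingLists (i :: I') (j :: J') ↔ HeadNonCrossing i j I' J' ∧ NonCrossingLists I' J' := by
  constructor
  · rintro ⟨h1, h2⟩
    refine ⟨fun y hy => ?_, fun s u v x y hu hv hx hy => ?_, fun s u x y hs hu hx hy => ?_⟩
    · cases I' with
      | nil => exact h2 0 i j y (by simp) (by simp) (by simp) (by simpa using hy)
      | cons v I' => exact h1 0 i v j y (by simp) (by simp) (by simp) (by simpa using hy)
    · exact h1 (s + 1) u v x y (by simpa using hu) (by simpa using hv) (by simpa using hx)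
        (by simpa using hy)
    · exact h2 (s + 1) u x y (by simpa using hs) (by simpa using hu) (by simpa using hx)
        (by simpa using hy)
  · rintro ⟨h0, h1, h2⟩
    refine ⟨fun s u v x y hu hv hx hy => ?_, fun s u x y hs hu hx hy => ?_⟩
    · cases s with
      | zero =>
        simp only [List.getElem?_cons_zero, Option.some.injEq, zero_add,
          List.getElem?_cons_succ] at hu hv hx hy
        subst hu hx
        simpa [hv] using h0 y hy
      | succ s =>
        exact h1 s u v x y (by simpa using hu) (by simpa using hv) (by simpa using hx)
          (by simpa using hy)
    · cases s with
      | zero =>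
        simp only [List.getElem?_cons_zero, Option.some.injEq, zero_add, List.length_cons,
          List.getElem?_cons_succ] at hs hu hx hy
        subst hu hx
        have : I' = [] := List.length_eq_zero_iff.mp (by omega)
        subst this
        simpa using h0 y hy
      | succ s =>
        exact h2 s u x y (by simpa using hs) (by simpa using hu) (by simpa using hx)
          (by simpa using hy)

/-- After removal of the common part, the leading entries stand for the first position in which
the two lists, continued by `⊤`, differ. -/
theorem headNonCrossing_removeCommon_iff (i j : α) : ∀ (l₁ l₂ : List α), ⊤ ∉ l₂ →
    l₁.length ≤ l₂.length →
    (HeadNonCrossing i j (removeCommon l₁ l₂).1 (removeCommon l₁ l₂).2 ↔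
      ∀ b, (∀ r < b, l₁.getD r ⊤ = l₂.getD r ⊤) →
        NonCrossingPairs i (l₁.getD b ⊤) j (l₂.getD b ⊤))
  | [], [], _, _ => by
    simp [removeCommon, HeadNonCrossing, nonCrossingPairs_of_eq]
  | [], y :: l₂, h₂, _ => by
    simp only [removeCommon, HeadNonCrossing]
    constructor
    · intro h b hb
      cases b with
      | zero => simpa using h y (by simp)
      | succ b =>
        have := hb 0 (by omega)
        simp only [List.getD_nil, List.getD_cons_zero] at this
        simp [← this] at h₂
    · intro h z hz
      simp only [List.getElem?_cons_zero, Option.some.injEq] at hz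
      subst hz
      simpa using h 0 (by simp)
  | _ :: _, [], _, h => by simp at h
  | u :: l₁, y :: l₂, h₂, hlen => by
    rw [removeCommon]
    split_ifs with huy
    · subst huy
      rw [headNonCrossing_removeCommon_iff i j l₁ l₂ (by simp at h₂; exact h₂.2)
        (by simpa using hlen)]
      constructor
      · intro h b hb
        cases b with
        | zero => exact nonCrossingPairs_of_eq (by simp)
        | succ b => simpa using h b fun r hr => by simpa using hb (r + 1) (by omega)
      · intro h b hb
        simpa using h (b + 1) fun r hr => by
          cases r with
          | zero => simp
          | succ r => simpa using hb r (by omega)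
    · simp only [HeadNonCrossing]
      constructor
      · intro h b hb
        cases b with
        | zero => simpa using h y (by simp)
        | succ b => exact absurd (by simpa using hb 0 (by omega)) huy
      · intro h z hz
        simp only [List.getElem?_cons_zero, Option.some.injEq] at hz
        subst hz
        simpa using h 0 (by simp)

/-- The non-crossing rule on lists says that no two positions `a < b` between which the lists,
continued by `⊤`, agree carry crossing pairs. -/
theorem nonCrossingLists_removeCommon_iff : ∀ (l₁ l₂ : List α), ⊤ ∉ l₂ →
    l₁.length ≤ l₂.length →
    (NonCrossingLists (removeCommon l₁ l₂).1 (removeCommon l₁ l₂).2 ↔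
      ∀ a b, a < b → (∀ r, a < r → r < b → l₁.getD r ⊤ = l₂.getD r ⊤) →
        NonCrossingPairs (l₁.getD a ⊤) (l₁.getD b ⊤) (l₂.getD a ⊤) (l₂.getD b ⊤))
  | [], l₂, _, _ => by
    simp [removeCommon, NonCrossingLists, NonCrossingPairs]
  | _ :: _, [], _, h => by simp at h
  | i :: l₁, j :: l₂, h₂, hlen => by
    have h₂' : ⊤ ∉ l₂ := by simp at h₂; exact h₂.2
    have hlen' : l₁.length ≤ l₂.length := by simpa using hlen
    have ih := nonCrossingLists_removeCommon_iff l₁ l₂ h₂' hlen'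
    have key : (∀ a b, a < b → (∀ r, a < r → r < b →
          (i :: l₁).getD r ⊤ = (j :: l₂).getD r ⊤) →
        NonCrossingPairs ((i :: l₁).getD a ⊤) ((i :: l₁).getD b ⊤)
          ((j :: l₂).getD a ⊤) ((j :: l₂).getD b ⊤)) ↔
        (∀ b, (∀ r < b, l₁.getD r ⊤ = l₂.getD r ⊤) →
          NonCrossingPairs i (l₁.getD b ⊤) j (l₂.getD b ⊤)) ∧
        ∀ a b, a < b → (∀ r, a < r → r < b → l₁.getD r ⊤ = l₂.getD r ⊤) →
          NonCrossingPairs (l₁.getD a ⊤) (l₁.getD b ⊤) (l₂.getD a ⊤) (l₂.getD b ⊤) := by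
      constructor
      · intro h
        refine ⟨fun b hb => ?_, fun a b hab hb => ?_⟩
        · simpa using h 0 (b + 1) (by omega) fun r h0 hr => by
            obtain ⟨r, rfl⟩ := Nat.exists_eq_succ_of_ne_zero h0.ne'
            simpa using hb r (by omega)
        · simpa using h (a + 1) (b + 1) (by omega) fun r h0 hr => by
            obtain ⟨r, rfl⟩ := Nat.exists_eq_succ_of_ne_zero (show r ≠ 0 by omega)
            simpa using hb r (by omega) (by omega)
      · rintro ⟨h0, h⟩ a b hab hb
        obtain ⟨b, rfl⟩ := Nat.exists_eq_succ_of_ne_zero (show b ≠ 0 by omega)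
        cases a with
        | zero => simpa using h0 b fun r hr => by simpa using hb (r + 1) (by omega) (by omega)
        | succ a =>
          simpa using h a b (by omega) fun r h1 h2 => by
            simpa using hb (r + 1) (by omega) (by omega)
    rw [key, removeCommon]
    split_ifs with hij
    · subst hij
      rw [ih]
      refine ⟨fun h => ⟨fun b _ => ?_, h⟩, fun h => h.2⟩
      exact ⟨fun h => lt_irrefl _ h.1, fun h => lt_irrefl _ h.1⟩
    · rw [nonCrossingLists_cons _ _ _ _ (length_removeCommon_le l₁ l₂ hlen'),
        headNonCrossing_removeCommon_iff i j l₁ l₂ h₂' hlen', ih]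

end Lists

/-- The entry in row `s` (counted from `0`) of the column `I`: the element number `s` of `I`,
and `m`, standing for `∞`, if `I` has no such element. -/
def col {m : ℕ} (I : Finset (Fin m)) (s : ℕ) : ℕ :=
  if h : s < I.card then (I.orderEmbOfFin rfl ⟨s, h⟩ : ℕ) else m

section Columns

variable {m : ℕ} (I J : Finset (Fin m))

theorem col_of_lt {s : ℕ} (h : s < I.card) : col I s = (I.orderEmbOfFin rfl ⟨s, h⟩ : ℕ) :=
  dif_pos h

theorem col_of_le {s : ℕ} (h : I.card ≤ s) : col I s = m := dif_neg (by omega)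

theorem col_lt {s : ℕ} (h : s < I.card) : col I s < m := by
  rw [col_of_lt I h]; exact Fin.is_lt _

theorem col_le (s : ℕ) : col I s ≤ m := by
  by_cases h : s < I.card
  · exact (col_lt I h).le
  · exact (col_of_le I (by omega)).le

theorem col_lt_iff {s : ℕ} : col I s < m ↔ s < I.card := by
  refine ⟨fun h => ?_, col_lt I⟩
  by_contra hs
  rw [col_of_le I (by omega)] at h
  exact lt_irrefl _ h

theorem col_lt_col {s t : ℕ} (hst : s < t) (hs : s < I.card) : col I s < col I t := by
  by_cases ht : t < I.card
  · rw [col_of_lt I hs, col_of_lt I ht]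
    exact (I.orderEmbOfFin rfl).strictMono (show (⟨s, hs⟩ : Fin _) < ⟨t, ht⟩ from hst)
  · rw [col_of_le I (s := t) (by omega)]
    exact col_lt I hs

theorem mem_iff_exists_col (i : Fin m) : i ∈ I ↔ ∃ s, col I s = i := by
  constructor
  · intro h
    have : i ∈ Set.range (I.orderEmbOfFin rfl) := by simpa using h
    obtain ⟨⟨s, hs⟩, rfl⟩ := this
    exact ⟨s, col_of_lt I hs⟩
  · rintro ⟨s, hs⟩
    have h := (col_lt_iff I).mp (hs.trans_lt i.is_lt)
    rw [col_of_lt I h] at hs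
    rw [← Fin.ext hs]
    exact I.orderEmbOfFin_mem rfl _

/-- A column is determined by its entries in the rows `0, …, m - 1`. -/
theorem eq_of_col_eq {I J : Finset (Fin m)} (h : ∀ s < m, col I s = col J s) : I = J := by
  have h' : ∀ s, col I s = col J s := fun s => by
    by_cases hs : s < m
    · exact h s hs
    · rw [col_of_le I ((card_finset_fin_le I).trans (by omega)),
        col_of_le J ((card_finset_fin_le J).trans (by omega))]
  ext i
  simp [mem_iff_exists_col, h']

/-- Every sequence that increases up to row `n` and equals `m = ∞` from there on is a column. -/
theorem exists_col_eq {n : ℕ} (g : ℕ → ℕ) (hg : ∀ s t, s < t → t < n → g s < g t)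
    (hlt : ∀ s < n, g s < m) (htop : ∀ s, n ≤ s → g s = m) :
    ∃ I : Finset (Fin m), I.card = n ∧ col I = g := by
  let f : Fin n → Fin m := fun s => ⟨g s, hlt s s.is_lt⟩
  have hf : StrictMono f := fun s t hst => hg s t hst t.is_lt
  have hc : (Finset.univ.image f).card = n := by
    rw [Finset.card_image_of_injective _ hf.injective, Finset.card_fin]
  refine ⟨Finset.univ.image f, hc, funext fun s => ?_⟩
  by_cases hs : s < n
  · rw [col_of_lt _ (hs.trans_eq hc.symm)]
    have := Finset.orderEmbOfFin_unique hc (f := f) (by simp) hf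
    have h2 := congrArg Fin.val (congrFun this ⟨s, hs⟩)
    rw [show g s = (f ⟨s, hs⟩ : ℕ) from rfl, h2]
    simp [Finset.orderEmbOfFin_apply]
  · rw [col_of_le _ (by omega), htop s (by omega)]

/-- Numerical value of an element of `[m] ∪ {∞}`. -/
def topVal : WithTop (Fin m) → ℕ := fun x => (x.map Fin.val).untopD m

theorem topVal_strictMono : StrictMono (topVal (m := m)) := by
  intro x y hxy
  induction x with
  | top => simp at hxy
  | coe x =>
    induction y with
    | top => exact x.is_lt
    | coe y => exact Fin.lt_def.mp (WithTop.coe_lt_coe.mp hxy)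

theorem topVal_increasingList (s : ℕ) : topVal ((increasingList I).getD s ⊤) = col I s := by
  by_cases h : s < I.card
  · rw [col_of_lt I h, List.getD_eq_getElem _ _ (by simpa [increasingList] using h)]
    simp only [increasingList, List.getElem_map, Finset.orderEmbOfFin_apply]
    rfl
  · rw [col_of_le I (by omega), List.getD_eq_default _ _ (by simpa [increasingList] using h)]
    simp [topVal]

theorem nonCrossingPairs_map {α : Type*} [LinearOrder α] {f : α → ℕ} (hf : StrictMono f)
    (u v x y : α) : NonCrossingPairs (f u) (f v) (f x) (f y) ↔ NonCrossingPairs u v x y := by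
  simp [NonCrossingPairs, hf.lt_iff_lt]

theorem NonCrossingPairs.comm {α : Type*} [LT α] {u v x y : α} :
    NonCrossingPairs u v x y ↔ NonCrossingPairs x y u v := and_comm

/-- Positions past the end of a column carry the value `m`, which plays the role of `∞` in the
list form of the rule. -/
theorem nonCrossingOfLE_iff (h : I.card ≤ J.card) : NonCrossingOfLE I J ↔
    ∀ a b, a < b → (∀ r, a < r → r < b → col I r = col J r) →
      NonCrossingPairs (col I a) (col I b) (col J a) (col J b) := by
  rw [NonCrossingOfLE, nonCrossingLists_removeCommon_iff _ _ (by simp [increasingList])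
    (by simpa [increasingList] using h)]
  simp_rw [← topVal_increasingList, nonCrossingPairs_map topVal_strictMono,
    topVal_strictMono.injective.eq_iff]

/-- The columns `I` and `J` cross if in some rows `a < b`, between which they agree, the pairs
`(I a, I b)` and `(J a, J b)` cross, with `I` starting and ending first. -/
def CrossAt (a b : ℕ) : Prop :=
  a < b ∧ (∀ r, a < r → r < b → col I r = col J r) ∧
    col I a < col J a ∧ col J a < col I b ∧ col I b < col J b

/-- The rule is symmetric in `I` and `J`, whatever their sizes. -/
theorem nonCrossing_iff : NonCrossing I J ↔ ∀ a b, ¬ CrossAt I J a b ∧ ¬ CrossAt J I a b := by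
  have key : NonCrossing I J ↔ ∀ a b, a < b → (∀ r, a < r → r < b → col I r = col J r) →
      NonCrossingPairs (col I a) (col I b) (col J a) (col J b) := by
    rw [NonCrossing]
    split_ifs with h
    · exact nonCrossingOfLE_iff I J h
    · rw [nonCrossingOfLE_iff J I (by omega)]
      simp_rw [NonCrossingPairs.comm (u := col J _), eq_comm (a := col J _)]
  rw [key]
  simp only [NonCrossingPairs, CrossAt]
  refine forall₂_congr fun a b => ⟨fun h => ⟨?_, ?_⟩, fun h hab heq => ⟨?_, ?_⟩⟩
  · rintro ⟨hab, heq, h'⟩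
    exact (h hab heq).2 h'
  · rintro ⟨hab, heq, h'⟩
    exact (h hab fun r h1 h2 => (heq r h1 h2).symm).1 h'
  · exact fun h' => h.2 ⟨hab, fun r h1 h2 => (heq r h1 h2).symm, h'⟩
  · exact fun h' => h.1 ⟨hab, heq, h'⟩

end Columns

/-! ### Uncrossing two columns -/

section Uncrossing

variable {m : ℕ} {I J : Finset (Fin m)}

theorem col_mono (I : Finset (Fin m)) : Monotone (col I) := by
  intro s t hst
  rcases hst.eq_or_lt with rfl | hst
  · exact le_rfl
  by_cases hs : s < I.card
  · exact (col_lt_col I hst hs).le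
  · rw [col_of_le I (s := s) (by omega), col_of_le I (s := t) (by omega)]

/-- Two crossing columns can exchange their tails from row `b` on. -/
theorem CrossAt.exists_uncrossing {a b : ℕ} (h : CrossAt I J a b) :
    ∃ I' J' : Finset (Fin m), I'.card = J.card ∧ J'.card = I.card ∧
      (col I' = fun r => if r < b then col I r else col J r) ∧
      (col J' = fun r => if r < b then col J r else col I r) := by
  obtain ⟨hab, heq, h1, h2, h3⟩ := h
  have hbI : b < I.card := (col_lt_iff I).mp (h3.trans_le (col_le J b))
  have haJ : a < J.card := (col_lt_iff J).mp (h2.trans_le (col_le I b))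
  have hbJ : b ≤ J.card := by
    by_contra hb
    have h4 := heq J.card haJ (by omega)
    have h5 := col_lt I (s := J.card) (by omega)
    rw [h4, col_of_le J le_rfl] at h5
    exact lt_irrefl _ h5
  obtain ⟨I', hI', hcI⟩ := exists_col_eq (m := m) (n := J.card)
    (fun r => if r < b then col I r else col J r)
    (by
      intro s t hst ht
      by_cases hs : s < b
      · by_cases ht : t < b
        · simpa [hs, ht] using col_lt_col I hst (by omega)
        · have := col_lt_col I hs (by omega)
          have := col_mono J (show b ≤ t by omega)
          simp only [hs, ht, if_true, if_false]
          omega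
      · have : ¬ t < b := by omega
        simpa [hs, this] using col_lt_col J hst (by omega))
    (by
      intro s hs
      split_ifs
      · exact col_lt I (by omega)
      · exact col_lt J hs)
    (by
      intro s hs
      rw [if_neg (by omega), col_of_le J hs])
  obtain ⟨J', hJ', hcJ⟩ := exists_col_eq (m := m) (n := I.card)
    (fun r => if r < b then col J r else col I r)
    (by
      intro s t hst ht
      by_cases hs : s < b
      · by_cases ht : t < b
        · simpa [hs, ht] using col_lt_col J hst (by omega)
        · have hs' : col J s < col I b := by
            by_cases hsa : s ≤ a
            · exact (col_mono J hsa).trans_lt h2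
            · rw [← heq s (by omega) hs]
              exact col_lt_col I hs (by omega)
          have := col_mono I (show b ≤ t by omega)
          simp only [hs, ht, if_true, if_false]
          omega
      · have : ¬ t < b := by omega
        simpa [hs, this] using col_lt_col I hst (by omega))
    (by
      intro s hs
      split_ifs
      · exact col_lt J (by omega)
      · exact col_lt I hs)
    (by
      intro s hs
      rw [if_neg (by omega), col_of_le I hs])
  exact ⟨I', J', hI', hJ', hcI, hcJ⟩

/-- The weights of a column continued by `∞ = m`: weight number `d` is the sum, over the rows
`a < m`, of the products of the entries in the rows `a` and `a + d`. -/
noncomputable def colWeight (I : Finset (Fin m)) : Fin m →₀ ℕ :=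
  Finsupp.equivFunOnFinite.symm fun d => ∑ a ∈ Finset.range m, col I a * col I (a + d)

/-- Uncrossing lowers the weights lexicographically: at distances less than `b - a` nothing
changes, and at distance `b - a` the rearrangement inequality applies to the rows `a` and `b`. -/
theorem CrossAt.colWeight_lt {a b : ℕ} (h : CrossAt I J a b) {I' J' : Finset (Fin m)}
    (hI' : col I' = fun r => if r < b then col I r else col J r)
    (hJ' : col J' = fun r => if r < b then col J r else col I r) :
    (MonomialOrder.lex (σ := Fin m)).toSyn (colWeight I' + colWeight J') <
      (MonomialOrder.lex (σ := Fin m)).toSyn (colWeight I + colWeight J) := by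
  obtain ⟨hab, heq, h1, h2, h3⟩ := h
  have hbI : b < I.card := (col_lt_iff I).mp (h3.trans_le (col_le J b))
  have hIm := card_finset_fin_le I
  -- the rows `r` and `r + d` are both kept, or both exchanged, or row `r` is common to `I` and `J`
  have hterm : ∀ r d, (r + d < b ∨ a < r) →
      col I' r * col I' (r + d) + col J' r * col J' (r + d) =
        col I r * col I (r + d) + col J r * col J (r + d) := by
    intro r d hr
    simp only [hI', hJ']
    by_cases hrb : r < b
    · by_cases hrd : r + d < b
      · simp [hrb, hrd]
      · simp only [hrb, hrd, if_true, if_false]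
        rw [heq r (by omega) hrb]
        ring
    · have hrd : ¬ r + d < b := by omega
      simp only [hrb, hrd, if_false]
      ring
  rw [MonomialOrder.lex_lt_iff]
  refine ⟨⟨b - a, by omega⟩, fun d hd => ?_, ?_⟩
  · have hd' : (d : ℕ) < b - a := hd
    simp only [colWeight, ofLex_toLex, Finsupp.add_apply, Finsupp.coe_equivFunOnFinite_symm,
      ← Finset.sum_add_distrib]
    exact Finset.sum_congr rfl fun r _ => hterm r d (by omega)
  · simp only [colWeight, ofLex_toLex, Finsupp.add_apply, Finsupp.coe_equivFunOnFinite_symm,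
      ← Finset.sum_add_distrib]
    have hlt : col I' a * col I' (a + (b - a)) + col J' a * col J' (a + (b - a)) <
        col I a * col I (a + (b - a)) + col J a * col J (a + (b - a)) := by
      have : a + (b - a) = b := by omega
      simp only [hI', hJ', this, hab, lt_irrefl, if_true, if_false]
      nlinarith
    refine Finset.sum_lt_sum (fun r _ => ?_) ⟨a, Finset.mem_range.mpr (by omega), hlt⟩
    rcases lt_trichotomy r a with hr | rfl | hr
    · exact (hterm r _ (by omega)).le
    · exact hlt.le
    · exact (hterm r _ (by omega)).le

end Uncrossing

/-! ### Uniqueness of non-crossing tableaux with given row contents -/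

section Uniqueness

variable {m : ℕ} {σ : Type*} [Fintype σ] (c : σ → Finset (Fin m))

/-- The first `s` entries of a column. -/
def colTrunc (s : ℕ) (I : Finset (Fin m)) : Fin s → ℕ := fun r => col I r

/-- The number of columns, counted with multiplicities `e`, whose first `s` entries are `t`. -/
def truncCount (e : σ → ℕ) (s : ℕ) (t : Fin s → ℕ) : ℕ :=
  ∑ i with colTrunc s (c i) = t, e i

/-- The number of columns, counted with multiplicities `e`, whose first `s` entries are `t` and
whose next entry is `v`. -/
def stepCount (e : σ → ℕ) (s : ℕ) (t : Fin s → ℕ) (v : ℕ) : ℕ :=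
  ∑ i with colTrunc s (c i) = t ∧ col (c i) s = v, e i

/-- The number of columns, counted with multiplicities `e`, with entry `v` in row `s`. -/
def rowCount (e : σ → ℕ) (s v : ℕ) : ℕ := ∑ i with col (c i) s = v, e i

theorem sum_rowCount (e : σ → ℕ) (s : ℕ) :
    ∑ v ∈ Finset.range (m + 1), rowCount c e s v = ∑ i, e i :=
  Finset.sum_fiberwise_of_maps_to
    (fun i _ => Finset.mem_range.mpr (Nat.lt_succ_of_le (col_le (c i) s))) e

theorem sum_stepCount_entry (e : σ → ℕ) (s : ℕ) (t : Fin s → ℕ) :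
    ∑ v ∈ Finset.range (m + 1), stepCount c e s t v = truncCount c e s t := by
  simp only [stepCount, truncCount, ← Finset.filter_filter]
  exact Finset.sum_fiberwise_of_maps_to
    (fun i _ => Finset.mem_range.mpr (Nat.lt_succ_of_le (col_le (c i) s))) e

theorem sum_stepCount_trunc (e : σ → ℕ) (s v : ℕ) :
    ∑ t ∈ Finset.univ.image (fun i => colTrunc s (c i)), stepCount c e s t v =
      rowCount c e s v := by
  simp only [stepCount, rowCount, and_comm (b := col _ _ = _), ← Finset.filter_filter]
  exact Finset.sum_fiberwise_of_maps_to (fun i _ => Finset.mem_image_of_mem _ (Finset.mem_univ i)) e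

theorem truncCount_succ (e : σ → ℕ) (s : ℕ) (t : Fin (s + 1) → ℕ) :
    truncCount c e (s + 1) t = stepCount c e s (Fin.init t) (t (Fin.last s)) := by
  simp only [truncCount, stepCount]
  congr 1
  ext i
  simp [funext_iff, Fin.forall_fin_succ', colTrunc, Fin.init]

theorem exists_of_stepCount_pos {e : σ → ℕ} {s : ℕ} {t : Fin s → ℕ} {v : ℕ}
    (h : 0 < stepCount c e s t v) :
    ∃ i, e i ≠ 0 ∧ (∀ r : Fin s, col (c i) r = t r) ∧ col (c i) s = v := by
  obtain ⟨i, hi, hpos⟩ := Finset.exists_ne_zero_of_sum_ne_zero h.ne'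
  simp only [Finset.mem_filter, Finset.mem_univ, true_and] at hi
  exact ⟨i, hpos, fun r => congrFun hi.1 r, hi.2⟩

/-- If `v` is the least entry whose distribution over the truncated columns differs in two
tableaux, then the first tableau has a surplus of `v` below `t₁` and, by the row sum, a surplus of
some larger entry below `t₂`; these two columns cross. -/
theorem false_of_stepCount_lt {e e' : σ → ℕ} {s : ℕ}
    (hnc : ∀ i j, e i ≠ 0 → e j ≠ 0 → NonCrossing (c i) (c j))
    {v : ℕ} {t₁ t₂ : Fin s → ℕ} (h₁ : stepCount c e' s t₁ v < stepCount c e s t₁ v)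
    (h₂ : stepCount c e s t₂ v < stepCount c e' s t₂ v)
    (hsum : truncCount c e s t₂ = truncCount c e' s t₂)
    (hmin : ∀ v' < v, stepCount c e s t₂ v' = stepCount c e' s t₂ v')
    (a : Fin s) (ha : t₁ a < t₂ a) (heq : ∀ r, a < r → t₁ r = t₂ r) : False := by
  obtain ⟨v', hv', hlt⟩ : ∃ v', v < v' ∧ stepCount c e' s t₂ v' < stepCount c e s t₂ v' := by
    by_contra! hcon
    refine hsum.not_lt ?_
    rw [← sum_stepCount_entry, ← sum_stepCount_entry]
    obtain ⟨k, -, -, hk⟩ := exists_of_stepCount_pos c (Nat.zero_lt_of_lt h₂)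
    have hvm : v ∈ Finset.range (m + 1) :=
      Finset.mem_range.mpr (Nat.lt_succ_of_le (hk ▸ col_le (c k) s))
    refine Finset.sum_lt_sum (fun w _ => ?_) ⟨v, hvm, h₂⟩
    rcases lt_trichotomy w v with hw | rfl | hw
    · exact (hmin w hw).le
    · exact h₂.le
    · exact hcon w hw
  obtain ⟨i, hi, hit, his⟩ := exists_of_stepCount_pos c (Nat.zero_lt_of_lt h₁)
  obtain ⟨j, hj, hjt, hjs⟩ := exists_of_stepCount_pos c (Nat.zero_lt_of_lt hlt)
  obtain ⟨k, -, hkt, hks⟩ := exists_of_stepCount_pos c (Nat.zero_lt_of_lt h₂)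
  refine ((nonCrossing_iff _ _).mp (hnc i j hi hj) a s).1 ⟨a.is_lt, fun r h1 h2 => ?_, ?_, ?_, ?_⟩
  · rw [hit ⟨r, h2⟩, hjt ⟨r, h2⟩]
    exact heq _ h1
  · rw [hit a, hjt a]
    exact ha
  · rw [hjt a, ← hkt a, his, ← hks]
    have hkm : col (c k) s < m := by
      rw [hks]
      exact hv'.trans_le (hjs ▸ col_le (c j) s)
    exact col_lt_col _ a.is_lt (a.is_lt.trans ((col_lt_iff _).mp hkm))
  · rw [his, hjs]
    exact hv'

theorem exists_last_ne {s : ℕ} {t₁ t₂ : Fin s → ℕ} (h : t₁ ≠ t₂) :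
    ∃ a, t₁ a ≠ t₂ a ∧ ∀ r, a < r → t₁ r = t₂ r := by
  obtain ⟨r, hr⟩ := Function.ne_iff.mp h
  obtain ⟨a, ha, hmax⟩ := (Finset.univ.filter fun r => t₁ r ≠ t₂ r).exists_max_image id
    ⟨r, by simpa using hr⟩
  refine ⟨a, by simpa using ha, fun r hr => ?_⟩
  by_contra hne
  exact absurd (hmax r (by simpa using hne)) (not_le.mpr hr)

theorem exists_stepCount_lt {e e' : σ → ℕ} {s v : ℕ} (hrow : rowCount c e s v = rowCount c e' s v)
    {t : Fin s → ℕ} (ht : stepCount c e s t v < stepCount c e' s t v) :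
    ∃ t, stepCount c e' s t v < stepCount c e s t v := by
  by_contra! hcon
  obtain ⟨i, -, hi, -⟩ := exists_of_stepCount_pos c (Nat.zero_lt_of_lt ht)
  refine hrow.not_lt ?_
  rw [← sum_stepCount_trunc, ← sum_stepCount_trunc]
  exact Finset.sum_lt_sum (fun t _ => hcon t)
    ⟨t, Finset.mem_image.mpr ⟨i, Finset.mem_univ i, funext hi⟩, ht⟩

theorem truncCount_eq_of_nonCrossing {e e' : σ → ℕ}
    (hnc : ∀ i j, e i ≠ 0 → e j ≠ 0 → NonCrossing (c i) (c j))
    (hnc' : ∀ i j, e' i ≠ 0 → e' j ≠ 0 → NonCrossing (c i) (c j))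
    (htotal : ∑ i, e i = ∑ i, e' i)
    (hrow : ∀ s v, rowCount c e s v = rowCount c e' s v) (s : ℕ) :
    ∀ t, truncCount c e s t = truncCount c e' s t := by
  induction s with
  | zero =>
    intro t
    simpa [truncCount, Subsingleton.elim _ t] using htotal
  | succ s ih =>
    intro t
    rw [truncCount_succ, truncCount_succ]
    generalize t (Fin.last s) = v
    generalize Fin.init t = t'
    induction v using Nat.strong_induction_on generalizing t' with
    | _ v hv =>
      by_contra hne
      obtain ⟨t₁, t₂, h₁, h₂⟩ : ∃ t₁ t₂, stepCount c e' s t₁ v < stepCount c e s t₁ v ∧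
          stepCount c e s t₂ v < stepCount c e' s t₂ v := by
        rcases Nat.lt_or_gt_of_ne hne with h | h
        · obtain ⟨t₁, h₁⟩ := exists_stepCount_lt c (hrow s v) h
          exact ⟨t₁, _, h₁, h⟩
        · obtain ⟨t₂, h₂⟩ := exists_stepCount_lt c (hrow s v).symm h
          exact ⟨_, t₂, h, h₂⟩
      obtain ⟨a, ha, heq⟩ := exists_last_ne (show t₁ ≠ t₂ by rintro rfl; omega)
      rcases Nat.lt_or_gt_of_ne ha with ha | ha
      · exact false_of_stepCount_lt c hnc h₁ h₂ (ih t₂) (fun v' h => hv v' h t₂) a ha heq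
      · exact false_of_stepCount_lt c hnc' h₂ h₁ (ih t₁).symm (fun v' h => (hv v' h t₁).symm) a ha
          fun r hr => (heq r hr).symm

/-- A non-crossing tableau without empty columns is determined by the contents of its rows. -/
theorem eq_of_nonCrossing_of_rowCount_eq (hc : Function.Injective c) (hne : ∀ i, (c i).Nonempty)
    {e e' : σ → ℕ} (hnc : ∀ i j, e i ≠ 0 → e j ≠ 0 → NonCrossing (c i) (c j))
    (hnc' : ∀ i j, e' i ≠ 0 → e' j ≠ 0 → NonCrossing (c i) (c j))
    (hrow : ∀ s, ∀ v < m, rowCount c e s v = rowCount c e' s v) : e = e' := by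
  have htotal : ∑ i, e i = ∑ i, e' i := by
    have hm : ∀ e : σ → ℕ, rowCount c e 0 m = 0 := fun e => by
      refine Finset.sum_eq_zero fun i hi => ?_
      simp only [Finset.mem_filter, Finset.mem_univ, true_and] at hi
      exact absurd hi (col_lt _ (Finset.card_pos.mpr (hne i))).ne
    rw [← sum_rowCount c e 0, ← sum_rowCount c e' 0, Finset.sum_range_succ, Finset.sum_range_succ,
      hm, hm]
    exact congrArg (· + 0) (Finset.sum_congr rfl fun v hv => hrow 0 v (Finset.mem_range.mp hv))
  have hrow' : ∀ s v, rowCount c e s v = rowCount c e' s v := by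
    intro s v
    rcases lt_trichotomy v m with h | rfl | h
    · exact hrow s v h
    · have h1 := sum_rowCount c e s
      have h2 := sum_rowCount c e' s
      rw [Finset.sum_range_succ] at h1 h2
      have h3 : ∑ w ∈ Finset.range v, rowCount c e s w = ∑ w ∈ Finset.range v, rowCount c e' s w :=
        Finset.sum_congr rfl fun w hw => hrow s w (Finset.mem_range.mp hw)
      omega
    · have : ∀ e : σ → ℕ, rowCount c e s v = 0 := fun e => by
        refine Finset.sum_eq_zero fun i hi => ?_
        simp only [Finset.mem_filter, Finset.mem_univ, true_and] at hi
        have := col_le (c i) s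
        omega
      rw [this, this]
  funext i
  have key : ∀ e : σ → ℕ, truncCount c e m (colTrunc m (c i)) = e i := fun e => by
    rw [truncCount, Finset.sum_eq_single_of_mem i (by simp)]
    intro j hj hji
    simp only [Finset.mem_filter, Finset.mem_univ, true_and] at hj
    exact absurd (hc (eq_of_col_eq fun s hs => congrFun hj ⟨s, hs⟩)) hji
  rw [← key e, ← key e', truncCount_eq_of_nonCrossing c hnc hnc' htotal hrow']

end Uniqueness

/-! ### Minors on the bottom rows and their leading terms -/

section Minors

variable {m : ℕ}

/-- The minor of the generic matrix on the first `k` rows with columns `h 0, …, h (k - 1)`, in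
this order and possibly with repetitions. -/
noncomputable def flagMinor {k : ℕ} (hk : k ≤ m) (h : Fin k → Fin m) :
    MvPolynomial (Fin m × Fin m) ℂ :=
  (Matrix.of fun r c : Fin k =>
    (MvPolynomial.X (Fin.castLE hk r, h c) : MvPolynomial (Fin m × Fin m) ℂ)).det

theorem flagMinor_orderEmbOfFin (I : Finset (Fin m)) :
    flagMinor (card_finset_fin_le I) (I.orderEmbOfFin rfl) = pluckerCoord I := rfl

theorem flagMinor_eq_pluckerCoord {k : ℕ} (hk : k ≤ m) {h : Fin k → Fin m} (hh : StrictMono h)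
    {A : Finset (Fin m)} (hA : A.card = k) (hmem : ∀ c, h c ∈ A) :
    flagMinor hk h = pluckerCoord A := by
  subst hA
  rw [Finset.orderEmbOfFin_unique rfl hmem hh, flagMinor_orderEmbOfFin]

theorem flagMinor_comp_perm {k : ℕ} (hk : k ≤ m) (h : Fin k → Fin m) (π : Equiv.Perm (Fin k)) :
    flagMinor hk (h ∘ π) = Equiv.Perm.sign π • flagMinor hk h := by
  have := Matrix.det_permute' π (Matrix.of fun r c : Fin k =>
    (MvPolynomial.X (Fin.castLE hk r, h c) : MvPolynomial (Fin m × Fin m) ℂ))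
  rw [Units.smul_def, zsmul_eq_mul]
  exact this

theorem flagMinor_eq_zero_or {k : ℕ} (hk : k ≤ m) (h : Fin k → Fin m) :
    flagMinor hk h = 0 ∨ ∃ (A : Finset (Fin m)) (ε : ℤˣ), A.card = k ∧
      ∑ i ∈ A, (i : ℕ) = ∑ c, (h c : ℕ) ∧ flagMinor hk h = ε • pluckerCoord A := by
  by_cases hh : Function.Injective h
  · right
    have hA : (Finset.univ.image h).card = k := by
      rw [Finset.card_image_of_injective _ hh, Finset.card_fin]
    refine ⟨Finset.univ.image h, (Equiv.Perm.sign (Tuple.sort h))⁻¹, hA, ?_, ?_⟩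
    · rw [Finset.sum_image hh.injOn]
    · have hs : StrictMono (h ∘ Tuple.sort h) :=
        (Tuple.monotone_sort h).strictMono_of_injective (hh.comp (Tuple.sort h).injective)
      rw [← flagMinor_eq_pluckerCoord hk hs hA (by simp), flagMinor_comp_perm, smul_smul,
        inv_mul_cancel, one_smul]
  · left
    simp only [Function.Injective, not_forall] at hh
    obtain ⟨c, c', hcc, hne⟩ := hh
    exact Matrix.det_zero_of_column_eq hne fun r => by simp [hcc]

/-- The exponent of the diagonal term of `x_I`. -/
noncomputable def diagExp (I : Finset (Fin m)) : Fin m × Fin m →₀ ℕ :=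
  ∑ c : Fin I.card, Finsupp.single (Fin.castLE (card_finset_fin_le I) c, I.orderEmbOfFin rfl c) 1

theorem diagExp_apply (I : Finset (Fin m)) (i j : Fin m) :
    diagExp I (i, j) = if col I i = j then 1 else 0 := by
  simp only [diagExp, Finsupp.finsetSum_apply, Finsupp.single_apply, Prod.mk.injEq]
  by_cases hi : (i : ℕ) < I.card
  · rw [Finset.sum_eq_single_of_mem ⟨i, hi⟩ (Finset.mem_univ _), col_of_lt I hi]
    · simp [Fin.ext_iff]
    · intro c _ hc
      exact if_neg fun h => hc (Fin.ext (show (c : ℕ) = i from congrArg Fin.val h.1))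
  · rw [col_of_le I (by omega), if_neg (by have := j.is_lt; omega)]
    refine Finset.sum_eq_zero fun c _ => if_neg fun h => hi ?_
    rw [← h.1]
    exact c.is_lt

theorem degree_eq_and_monic {σ : Type*} (ord : MonomialOrder σ) {f : MvPolynomial σ ℂ}
    {d : σ →₀ ℕ} (hd : f.coeff d = 1) (hle : ∀ e ∈ f.support, ord.toSyn e ≤ ord.toSyn d) :
    ord.degree f = d ∧ ord.Monic f := by
  have h : ord.degree f = d := by
    refine ord.toSyn.injective (le_antisymm (ord.degree_le_iff.mpr hle) (ord.le_degree ?_))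
    simp [hd]
  exact ⟨h, by rw [MonomialOrder.Monic, MonomialOrder.leadingCoeff, h, hd]⟩

theorem exists_first_moved {k : ℕ} {π : Equiv.Perm (Fin k)} (h : π ≠ 1) :
    ∃ r, π r ≠ r ∧ ∀ r' < r, π r' = r' := by
  obtain ⟨r, hr⟩ : ∃ r, π r ≠ r := by
    by_contra! hcon
    exact h (Equiv.ext hcon)
  obtain ⟨a, ha, hmin⟩ := (Finset.univ.filter fun r => π r ≠ r).exists_min_image id
    ⟨r, by simpa using hr⟩
  refine ⟨a, by simpa using ha, fun r hr => ?_⟩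
  by_contra hne
  exact absurd (hmin r (by simpa using hne)) (not_le.mpr hr)

/-- In the diagonal order each off-diagonal term of a minor is less than the diagonal one: they
first differ in the first row moved by the permutation. -/
theorem perm_exponent_lt (I : Finset (Fin m)) {π : Equiv.Perm (Fin I.card)} (hπ : π ≠ 1) :
    (diagonalOrder m).toSyn (∑ c, Finsupp.single
        (Fin.castLE (card_finset_fin_le I) (π c), I.orderEmbOfFin rfl c) 1) <
      (diagonalOrder m).toSyn (diagExp I) := by
  obtain ⟨r, hr, hfix⟩ := exists_first_moved hπ
  have hinj := (I.orderEmbOfFin rfl).injective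
  have hmono := (I.orderEmbOfFin rfl).strictMono
  refine diagonalOrder_lt_of (Fin.castLE (card_finset_fin_le I) r) (I.orderEmbOfFin rfl r) ?_ ?_ ?_
  · intro i' hi' j'
    simp only [diagExp, Finsupp.finsetSum_apply, Finsupp.single_apply, Prod.mk.injEq]
    refine Finset.sum_congr rfl fun c _ => ?_
    obtain ⟨r', hr', rfl⟩ : ∃ r' < r, Fin.castLE (card_finset_fin_le I) r' = i' :=
      ⟨⟨i', lt_trans hi' r.is_lt⟩, hi', rfl⟩
    have : π c = r' ↔ c = r' := by
      rw [← hfix r' hr', π.injective.eq_iff, hfix r' hr']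
    simp [this]
  · intro j' hj'
    simp only [diagExp, Finsupp.finsetSum_apply, Finsupp.single_apply, Prod.mk.injEq]
    refine Finset.sum_congr rfl fun c _ => ?_
    rw [if_neg, if_neg]
    · rintro ⟨h1, rfl⟩
      rw [(Fin.castLE_injective _ h1 : c = r)] at hj'
      exact lt_irrefl _ hj'
    · rintro ⟨h1, rfl⟩
      have hcr : c < r := hmono.lt_iff_lt.mp hj'
      rw [hfix c hcr] at h1
      exact hcr.ne (Fin.castLE_injective _ h1)
  · simp only [diagExp, Finsupp.finsetSum_apply, Finsupp.single_apply, Prod.mk.injEq]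
    rw [Finset.sum_eq_zero, Finset.sum_eq_single_of_mem r (Finset.mem_univ _)]
    · simp
    · intro c _ hc
      exact if_neg fun h => hc (hinj h.2)
    · intro c _
      refine if_neg fun h => hr ?_
      have hc := hinj h.2
      subst hc
      exact Fin.castLE_injective _ h.1

theorem pluckerCoord_eq_sum (I : Finset (Fin m)) :
    pluckerCoord I = ∑ π : Equiv.Perm (Fin I.card), MvPolynomial.monomial (∑ c, Finsupp.single
        (Fin.castLE (card_finset_fin_le I) (π c), I.orderEmbOfFin rfl c) 1)
        (((Equiv.Perm.sign π : ℤˣ) : ℤ) : ℂ) := by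
  rw [← flagMinor_orderEmbOfFin, flagMinor, Matrix.det_apply']
  refine Finset.sum_congr rfl fun π _ => ?_
  rw [MvPolynomial.monomial_sum_index, map_intCast]
  rfl

theorem degree_pluckerCoord_and_monic (I : Finset (Fin m)) :
    (diagonalOrder m).degree (pluckerCoord I) = diagExp I ∧
      (diagonalOrder m).Monic (pluckerCoord I) := by
  apply degree_eq_and_monic
  · rw [pluckerCoord_eq_sum, MvPolynomial.coeff_sum,
      Finset.sum_eq_single_of_mem 1 (Finset.mem_univ _)]
    · rw [MvPolynomial.coeff_monomial, if_pos (by rfl)]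
      simp
    · intro π _ hπ
      rw [MvPolynomial.coeff_monomial, if_neg]
      intro h
      exact (perm_exponent_lt I hπ).ne (congrArg _ h)
  · intro e he
    rw [pluckerCoord_eq_sum] at he
    obtain ⟨π, -, hπ⟩ := Finset.mem_biUnion.mp (MvPolynomial.support_sum he)
    rw [Finset.mem_singleton.mp (MvPolynomial.support_monomial_subset hπ)]
    by_cases h : π = 1
    · subst h
      exact le_rfl
    · exact (perm_exponent_lt I h).le

theorem degree_pluckerCoord (I : Finset (Fin m)) :
    (diagonalOrder m).degree (pluckerCoord I) = diagExp I := (degree_pluckerCoord_and_monic I).1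

theorem monic_pluckerCoord (I : Finset (Fin m)) : (diagonalOrder m).Monic (pluckerCoord I) :=
  (degree_pluckerCoord_and_monic I).2

theorem degree_pluckerCoord_mul (I J : Finset (Fin m)) :
    (diagonalOrder m).degree (pluckerCoord I * pluckerCoord J) = diagExp I + diagExp J := by
  rw [MonomialOrder.degree_mul (monic_pluckerCoord I).ne_zero (monic_pluckerCoord J).ne_zero,
    degree_pluckerCoord, degree_pluckerCoord]

end Minors

/-! ### Straightening products of two minors -/

section Straightening

variable {m : ℕ}

/-- Garnir relation: antisymmetrizing a product of two minors with at most `k` rows over more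
than `k` of their columns gives zero, since two of these columns are always expanded along the
same row. -/
theorem sum_sign_flagMinor_mul_flagMinor {k l : ℕ} (hk : k ≤ m) (hl : l ≤ k)
    (g : Fin k ⊕ Fin l → Fin m) (T : Finset (Fin k ⊕ Fin l)) (hT : k < T.card) :
    ∑ σ : Equiv.Perm T, Equiv.Perm.sign σ •
      (flagMinor hk (fun c => g (Equiv.Perm.ofSubtype σ (Sum.inl c))) *
        flagMinor (hl.trans hk) (fun c => g (Equiv.Perm.ofSubtype σ (Sum.inr c)))) = 0 := by
  let row (π : Equiv.Perm (Fin k)) (ρ : Equiv.Perm (Fin l)) : Fin k ⊕ Fin l → Fin k :=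
    Sum.elim π (fun c => Fin.castLE hl (ρ c))
  let x (r : Fin k) (j : Fin m) : MvPolynomial (Fin m × Fin m) ℂ :=
    MvPolynomial.X (Fin.castLE hk r, j)
  have hexp : ∀ σ : Equiv.Perm T,
      flagMinor hk (fun c => g (Equiv.Perm.ofSubtype σ (Sum.inl c))) *
        flagMinor (hl.trans hk) (fun c => g (Equiv.Perm.ofSubtype σ (Sum.inr c))) =
      ∑ π : Equiv.Perm (Fin k), ∑ ρ : Equiv.Perm (Fin l),
        (Equiv.Perm.sign π * Equiv.Perm.sign ρ) •
          ((∏ t : T, x (row π ρ t) (g (σ t))) * ∏ t ∈ Tᶜ, x (row π ρ t) (g t)) := by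
    intro σ
    rw [flagMinor, flagMinor, Matrix.det_apply, Matrix.det_apply, Finset.sum_mul_sum]
    refine Finset.sum_congr rfl fun π _ => Finset.sum_congr rfl fun ρ _ => ?_
    rw [smul_mul_smul_comm]
    congr 1
    have h1 : ∏ t : T, x (row π ρ t) (g (σ t)) =
        ∏ t ∈ T, x (row π ρ t) (g (Equiv.Perm.ofSubtype σ t)) := by
      rw [← Finset.prod_coe_sort T]
      exact Finset.prod_congr rfl fun t _ => by rw [Equiv.Perm.ofSubtype_apply_coe]
    have h2 : ∏ t ∈ Tᶜ, x (row π ρ t) (g t) =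
        ∏ t ∈ Tᶜ, x (row π ρ t) (g (Equiv.Perm.ofSubtype σ t)) :=
      Finset.prod_congr rfl fun t ht => by
        rw [Equiv.Perm.ofSubtype_apply_of_not_mem σ (Finset.mem_compl.mp ht)]
    rw [h1, h2, Finset.prod_mul_prod_compl, Fintype.prod_sum_type]
    rfl
  simp_rw [hexp, Finset.smul_sum]
  rw [Finset.sum_comm]
  refine Finset.sum_eq_zero fun π _ => ?_
  rw [Finset.sum_comm]
  refine Finset.sum_eq_zero fun ρ _ => ?_
  have hdet : ∑ σ : Equiv.Perm T, Equiv.Perm.sign σ • ∏ t : T, x (row π ρ t) (g (σ t)) = 0 := by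
    obtain ⟨t, ht, t', ht', hne, hrow⟩ := Finset.exists_ne_map_eq_of_card_lt_of_maps_to
      (s := T) (t := Finset.univ) (by simpa using hT) (f := row π ρ) (by simp)
    have := Matrix.det_zero_of_column_eq (M := Matrix.of fun t u : T => x (row π ρ u) (g t))
      (i := ⟨t, ht⟩) (j := ⟨t', ht'⟩) (by simpa using hne) (fun u => by simp [hrow])
    rw [Matrix.det_apply] at this
    exact this
  simp_rw [smul_comm _ (Equiv.Perm.sign π * Equiv.Perm.sign ρ)]
  rw [← Finset.smul_sum]
  simp_rw [← smul_mul_assoc]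
  rw [← Finset.sum_mul, hdet, zero_mul, smul_zero]

/-- Sums over two distinct sets `U`, `V` of the same size, when everything in `U \ V` is less than
everything in `V \ U`. -/
theorem sum_lt_sum_of_sdiff {α : Type*} [DecidableEq α] {U V : Finset α} (hcard : U.card = V.card)
    (hne : U ≠ V) (g : α → ℕ) (N : ℕ) (hU : ∀ x ∈ U \ V, g x < N) (hV : ∀ x ∈ V \ U, N ≤ g x) :
    ∑ x ∈ U, g x < ∑ x ∈ V, g x := by
  have h1 := Finset.sum_inter_add_sum_sdiff U V g
  have h2 := Finset.sum_inter_add_sum_sdiff V U g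
  rw [Finset.inter_comm] at h2
  have h3 : (U \ V).card = (V \ U).card := Finset.card_sdiff_comm hcard
  have h4 : (U \ V).Nonempty := by
    rw [Finset.sdiff_nonempty]
    exact fun h => hne (Finset.eq_of_subset_of_card_le h hcard.ge)
  have h5 : ∑ x ∈ U \ V, g x < (U \ V).card * N := by
    have := Finset.sum_lt_sum_of_nonempty h4 hU
    simpa using this
  have h6 : (V \ U).card • N ≤ ∑ x ∈ V \ U, g x := Finset.card_nsmul_le_sum _ g N hV
  rw [smul_eq_mul, ← h3] at h6
  omega

/-- A product of two minors which is not semistandard in row `s` is a combination of products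
in which the element sum of the longer column is smaller. -/
theorem pluckerCoord_mul_mem_span_of_violation {I J : Finset (Fin m)} (hJI : J.card ≤ I.card)
    {s : ℕ} (hs : s < J.card) (hv : col J s < col I s) :
    pluckerCoord I * pluckerCoord J ∈ Submodule.span ℂ {f | ∃ A B : Finset (Fin m),
      A.card = I.card ∧ B.card = J.card ∧ ∑ i ∈ A, (i : ℕ) < ∑ i ∈ I, (i : ℕ) ∧
        pluckerCoord A * pluckerCoord B = f} := by
  set W := Submodule.span ℂ {f | ∃ A B : Finset (Fin m),
      A.card = I.card ∧ B.card = J.card ∧ ∑ i ∈ A, (i : ℕ) < ∑ i ∈ I, (i : ℕ) ∧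
        pluckerCoord A * pluckerCoord B = f} with hW
  let sI : Fin I.card := ⟨s, by omega⟩
  let sJ : Fin J.card := ⟨s, hs⟩
  let g : Fin I.card ⊕ Fin J.card → Fin m :=
    Sum.elim (I.orderEmbOfFin rfl) (J.orderEmbOfFin rfl)
  -- the columns from row `s` on in `I`, and up to row `s` in `J`
  let T : Finset (Fin I.card ⊕ Fin J.card) := (Finset.Ici sI).disjSum (Finset.Iic sJ)
  have hT : I.card < T.card := by
    rw [Finset.card_disjSum, Fin.card_Ici, Fin.card_Iic]
    simp only [sI, sJ]
    omega
  let P : Equiv.Perm T → MvPolynomial (Fin m × Fin m) ℂ := fun σ => Equiv.Perm.sign σ •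
      (flagMinor (card_finset_fin_le I) (fun c => g (Equiv.Perm.ofSubtype σ (Sum.inl c))) *
        flagMinor (hJI.trans (card_finset_fin_le I))
          (fun c => g (Equiv.Perm.ofSubtype σ (Sum.inr c))))
  have hsum : ∑ σ, P σ = 0 :=
    sum_sign_flagMinor_mul_flagMinor (card_finset_fin_le I) hJI g T hT
  let H : Equiv.Perm T → Prop := fun σ =>
    Set.MapsTo (Equiv.Perm.ofSubtype σ) (Set.range Sum.inl) (Set.range Sum.inl)
  classical
  -- a permutation preserving the two column sets only reorders the columns of each minor
  have hin : ∀ σ, H σ → P σ = pluckerCoord I * pluckerCoord J := by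
    intro σ hσ
    obtain ⟨⟨π, ρ⟩, hπρ⟩ := Equiv.Perm.mem_sumCongrHom_range_of_perm_mapsTo_inl hσ
    rw [Equiv.Perm.sumCongrHom_apply] at hπρ
    have hsign : Equiv.Perm.sign σ = Equiv.Perm.sign π * Equiv.Perm.sign ρ := by
      rw [← Equiv.Perm.sign_ofSubtype σ, ← hπρ, Equiv.Perm.sign_sumCongr]
    have h1 : (fun c => g (Equiv.Perm.ofSubtype σ (Sum.inl c))) = I.orderEmbOfFin rfl ∘ π := by
      rw [← hπρ]; rfl
    have h2 : (fun c => g (Equiv.Perm.ofSubtype σ (Sum.inr c))) = J.orderEmbOfFin rfl ∘ ρ := by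
      rw [← hπρ]; rfl
    simp only [P]
    rw [h1, h2, flagMinor_comp_perm, flagMinor_comp_perm, flagMinor_orderEmbOfFin,
      flagMinor_orderEmbOfFin, smul_mul_smul_comm, hsign, smul_smul, Int.units_mul_self, one_smul]
  -- any other one moves columns of `I` that are at least `col I s` to the second minor, in
  -- exchange for columns of `J` that are at most `col J s`
  have hout : ∀ σ, ¬ H σ → P σ ∈ W := by
    intro σ hσ
    have hlt : ∑ c, (g (Equiv.Perm.ofSubtype σ (Sum.inl c)) : ℕ) < ∑ i ∈ I, (i : ℕ) := by
      let V : Finset (Fin I.card ⊕ Fin J.card) := Finset.univ.image Sum.inl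
      have hinj : Function.Injective
          (fun c : Fin I.card => Equiv.Perm.ofSubtype σ (Sum.inl c : Fin I.card ⊕ Fin J.card)) :=
        (Equiv.injective _).comp Sum.inl_injective
      let U : Finset (Fin I.card ⊕ Fin J.card) :=
        Finset.univ.image (fun c => Equiv.Perm.ofSubtype σ (Sum.inl c))
      have hVsum : ∑ x ∈ V, (g x : ℕ) = ∑ i ∈ I, (i : ℕ) := by
        rw [Finset.sum_image Sum.inl_injective.injOn]
        conv_rhs => rw [← Finset.image_orderEmbOfFin_univ I rfl]
        rw [Finset.sum_image (I.orderEmbOfFin rfl).injective.injOn]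
        rfl
      have hUsum : ∑ x ∈ U, (g x : ℕ) =
          ∑ c, (g (Equiv.Perm.ofSubtype σ (Sum.inl c)) : ℕ) := Finset.sum_image hinj.injOn
      rw [← hVsum, ← hUsum]
      refine sum_lt_sum_of_sdiff ?_ ?_ _ (col I s) ?_ ?_
      · rw [Finset.card_image_of_injective _ hinj,
          Finset.card_image_of_injective _ Sum.inl_injective]
      · intro hUV
        refine hσ ?_
        rintro _ ⟨c, rfl⟩
        have : Equiv.Perm.ofSubtype σ (Sum.inl c) ∈ V :=
          hUV ▸ Finset.mem_image_of_mem _ (Finset.mem_univ c)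
        simpa [V] using this
      · intro x hx
        obtain ⟨hxU, hxV⟩ := Finset.mem_sdiff.mp hx
        obtain ⟨c, -, rfl⟩ := Finset.mem_image.mp hxU
        have hc : (Sum.inl c : Fin I.card ⊕ Fin J.card) ∈ T := by
          by_contra hc
          rw [Equiv.Perm.ofSubtype_apply_of_not_mem σ hc] at hxV
          exact hxV (Finset.mem_image_of_mem _ (Finset.mem_univ c))
        have hx := Equiv.Perm.ofSubtype_apply_of_mem σ hc
        have hmem : Equiv.Perm.ofSubtype σ (Sum.inl c) ∈ T := hx ▸ (σ ⟨_, hc⟩).2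
        revert hmem hxV
        generalize Equiv.Perm.ofSubtype σ (Sum.inl c) = y
        rintro hyV hyT
        rcases y with y | y
        · exact absurd (Finset.mem_image_of_mem _ (Finset.mem_univ y)) hyV
        · have hy : y ≤ sJ := by simpa [T] using hyT
          refine lt_of_le_of_lt ?_ hv
          rw [col_of_lt J hs]
          exact (J.orderEmbOfFin rfl).monotone hy
      · intro x hx
        obtain ⟨hxV, hxU⟩ := Finset.mem_sdiff.mp hx
        obtain ⟨c, -, rfl⟩ := Finset.mem_image.mp hxV
        have hc : (Sum.inl c : Fin I.card ⊕ Fin J.card) ∈ T := by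
          by_contra hc
          refine hxU ?_
          have := Equiv.Perm.ofSubtype_apply_of_not_mem σ hc
          exact Finset.mem_image.mpr ⟨c, Finset.mem_univ c, this⟩
        have hy : sI ≤ c := by simpa [T] using hc
        rw [col_of_lt I (by omega)]
        exact (I.orderEmbOfFin rfl).monotone hy
    have hP : P σ = Equiv.Perm.sign σ •
      (flagMinor (card_finset_fin_le I) (fun c => g (Equiv.Perm.ofSubtype σ (Sum.inl c))) *
        flagMinor (hJI.trans (card_finset_fin_le I))
          (fun c => g (Equiv.Perm.ofSubtype σ (Sum.inr c)))) := rfl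
    rw [hP]
    rcases flagMinor_eq_zero_or (card_finset_fin_le I)
      (fun c => g (Equiv.Perm.ofSubtype σ (Sum.inl c))) with h | ⟨A, ε, hA, hsA, h⟩
    · simp [h]
    rcases flagMinor_eq_zero_or (hJI.trans (card_finset_fin_le I))
      (fun c => g (Equiv.Perm.ofSubtype σ (Sum.inr c))) with h' | ⟨B, δ, hB, -, h'⟩
    · simp [h']
    rw [h, h', smul_mul_smul_comm, smul_smul, Units.smul_def]
    have hAB : pluckerCoord A * pluckerCoord B ∈ W :=
      Submodule.subset_span ⟨A, B, hA, hB, hsA ▸ hlt, rfl⟩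
    exact zsmul_mem hAB _
  have hsplit : (Finset.univ.filter H).card • (pluckerCoord I * pluckerCoord J) +
      ∑ σ with ¬ H σ, P σ = 0 := by
    rw [← hsum, ← Finset.sum_filter_add_sum_filter_not Finset.univ H P,
      Finset.sum_congr rfl (fun σ hσ => hin σ (Finset.mem_filter.mp hσ).2), Finset.sum_const]
  have hmem : ((Finset.univ.filter H).card : ℂ) • (pluckerCoord I * pluckerCoord J) ∈ W := by
    rw [Nat.cast_smul_eq_nsmul, eq_neg_of_add_eq_zero_left hsplit]
    exact neg_mem (sum_mem fun σ hσ => hout σ (Finset.mem_filter.mp hσ).2)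
  have h1 : (1 : Equiv.Perm T) ∈ Finset.univ.filter H := by
    simp [H, Set.MapsTo]
  have hne : ((Finset.univ.filter H).card : ℂ) ≠ 0 :=
    Nat.cast_ne_zero.mpr (Finset.card_ne_zero_of_mem h1)
  exact (W.smul_mem_iff hne).mp hmem

/-- Products of two minors are spanned by the semistandard ones. -/
theorem pluckerCoord_mul_mem_span_semistandard (n : ℕ) : ∀ I J : Finset (Fin m),
    J.card ≤ I.card → ∑ i ∈ I, (i : ℕ) = n →
    pluckerCoord I * pluckerCoord J ∈ Submodule.span ℂ {f | ∃ A B : Finset (Fin m),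
      A.card = I.card ∧ B.card = J.card ∧ (∀ s, col A s ≤ col B s) ∧
        pluckerCoord A * pluckerCoord B = f} := by
  induction n using Nat.strong_induction_on with
  | _ n ih =>
    intro I J hJI hn
    by_cases hss : ∀ s, col I s ≤ col J s
    · exact Submodule.subset_span ⟨I, J, rfl, rfl, hss, rfl⟩
    · push Not at hss
      obtain ⟨s, hs⟩ := hss
      have hsJ : s < J.card := (col_lt_iff J).mp (hs.trans_le (col_le I s))
      refine Submodule.span_le.mpr ?_ (pluckerCoord_mul_mem_span_of_violation hJI hsJ hs)
      rintro _ ⟨A, B, hA, hB, hlt, rfl⟩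
      have := ih _ (hn ▸ hlt) A B (by omega) rfl
      rwa [hA, hB] at this

/-- A semistandard pair is determined by its row contents: in each row the smaller entry belongs to
the first column. -/
theorem eq_of_semistandard_of_diagExp_eq {A B A' B' : Finset (Fin m)}
    (h : ∀ s, col A s ≤ col B s) (h' : ∀ s, col A' s ≤ col B' s)
    (hd : diagExp A + diagExp B = diagExp A' + diagExp B') : A = A' ∧ B = B' := by
  have key : ∀ s < m, col A s = col A' s ∧ col B s = col B' s := by
    intro s hs
    have hcount : ∀ v < m, (if col A s = v then 1 else 0) + (if col B s = v then 1 else 0) =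
        (if col A' s = v then 1 else 0) + (if col B' s = v then 1 else 0) := by
      intro v hv
      have := DFunLike.congr_fun hd (⟨s, hs⟩, ⟨v, hv⟩)
      simpa [diagExp_apply] using this
    have h1 := h s
    have h2 := h' s
    have hA := col_le A s
    have hB := col_le B s
    have hA' := col_le A' s
    have hB' := col_le B' s
    have e1 := hcount (col A s)
    have e2 := hcount (col B s)
    have e3 := hcount (col A' s)
    have e4 := hcount (col B' s)
    grind
  exact ⟨eq_of_col_eq fun s hs => (key s hs).1, eq_of_col_eq fun s hs => (key s hs).2⟩

/-- Two products of two minors with the same leading term differ by products with smaller leading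
terms. -/
theorem pluckerCoord_mul_sub_mem_span {I J I' J' : Finset (Fin m)} (hI' : I'.card = J.card)
    (hJ' : J'.card = I.card) (hd : diagExp I + diagExp J = diagExp I' + diagExp J') :
    pluckerCoord I * pluckerCoord J - pluckerCoord I' * pluckerCoord J' ∈
      Submodule.span ℂ {f | ∃ A B : Finset (Fin m), A.card = I.card ∧ B.card = J.card ∧
        (diagonalOrder m).toSyn (diagExp A + diagExp B) <
          (diagonalOrder m).toSyn (diagExp I + diagExp J) ∧
        pluckerCoord A * pluckerCoord B = f} := by
  wlog hJI : J.card ≤ I.card generalizing I J I' J'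
  · have := this (I := J) (J := I) (I' := J') (J' := I') hJ' hI'
      (by rw [add_comm, hd, add_comm]) (by omega)
    rw [mul_comm (pluckerCoord I), mul_comm (pluckerCoord I')]
    refine Submodule.span_mono ?_ this
    rintro _ ⟨A, B, hA, hB, hlt, rfl⟩
    exact ⟨B, A, hB, hA, by rwa [add_comm (diagExp B), add_comm (diagExp I)], mul_comm _ _⟩
  set f := pluckerCoord I * pluckerCoord J - pluckerCoord I' * pluckerCoord J' with hf
  have hdeg : f ≠ 0 → (diagonalOrder m).toSyn ((diagonalOrder m).degree f) <
      (diagonalOrder m).toSyn (diagExp I + diagExp J) := by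
    intro hf0
    refine lt_of_le_of_ne ?_ fun h => ?_
    · refine (diagonalOrder m).degree_sub_le.trans ?_
      rw [degree_pluckerCoord_mul, degree_pluckerCoord_mul, ← hd, sup_idem]
    · have h0 := (diagonalOrder m).coeff_degree_ne_zero_iff.mpr hf0
      rw [(diagonalOrder m).toSyn.injective h, hf, MvPolynomial.coeff_sub] at h0
      have h1 := ((monic_pluckerCoord I).mul (monic_pluckerCoord J)).coeff_degree
      have h2 := ((monic_pluckerCoord I').mul (monic_pluckerCoord J')).coeff_degree
      rw [degree_pluckerCoord_mul] at h1 h2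
      rw [← hd] at h2
      rw [h1, h2, sub_self] at h0
      exact h0 rfl
  let ι := {p : Finset (Fin m) × Finset (Fin m) //
    p.1.card = I.card ∧ p.2.card = J.card ∧ ∀ s, col p.1 s ≤ col p.2 s}
  let g : ι → MvPolynomial (Fin m × Fin m) ℂ := fun p => pluckerCoord p.1.1 * pluckerCoord p.1.2
  have hfg : f ∈ Submodule.span ℂ (Set.range g) := by
    have hset : {f | ∃ A B : Finset (Fin m), A.card = I.card ∧ B.card = J.card ∧
        (∀ s, col A s ≤ col B s) ∧ pluckerCoord A * pluckerCoord B = f} ⊆ Set.range g := by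
      rintro _ ⟨A, B, hA, hB, hAB, rfl⟩
      exact ⟨⟨(A, B), hA, hB, hAB⟩, rfl⟩
    refine sub_mem (Submodule.span_mono hset
      (pluckerCoord_mul_mem_span_semistandard _ I J hJI rfl)) (Submodule.span_mono hset ?_)
    rw [mul_comm]
    have := pluckerCoord_mul_mem_span_semistandard _ J' I' (by omega) rfl
    rwa [hI', hJ'] at this
  obtain ⟨c, hc⟩ := Finsupp.mem_span_range_iff_exists_finsupp.mp hfg
  have hgdeg : ∀ p, (diagonalOrder m).degree (g p) = diagExp p.1.1 + diagExp p.1.2 := fun p =>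
    degree_pluckerCoord_mul _ _
  have hginj : Function.Injective fun p => (diagonalOrder m).degree (g p) := by
    intro p q hpq
    simp only [hgdeg] at hpq
    have := eq_of_semistandard_of_diagExp_eq p.2.2.2 q.2.2.2 hpq
    exact Subtype.ext (Prod.ext this.1 this.2)
  rw [← hc]
  refine sum_mem fun p hp => Submodule.smul_mem _ _ (Submodule.subset_span ?_)
  obtain ⟨h0, hle⟩ := degree_le_degree_linearCombination (diagonalOrder m) g
    (fun p => mul_ne_zero (monic_pluckerCoord _).ne_zero (monic_pluckerCoord _).ne_zero) c
    hginj.injOn (Finsupp.mem_support_iff.mp hp)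
  rw [Finsupp.linearCombination_apply, hc] at h0 hle
  exact ⟨p.1.1, p.1.2, p.2.1, p.2.2.1, (hgdeg p ▸ hle).trans_lt (hdeg h0), rfl⟩

end Straightening

/-! ### Paths in a partial staircase -/

/-- Whether a path fits in a partial staircase depends only on its endpoint, since the staircase is
closed under passing to the south and west. -/
theorem PathFits.of_card_eq {m : ℕ} {S : Set (ℕ × ℕ)}
    {I J : Finset (Fin m)} (hI : PathFits (partialStaircase S) I) (hJI : J.card = I.card) :
    PathFits (partialStaircase S) J := by
  intro t _
  obtain ⟨s, hs, hle⟩ := hI m le_rfl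
  have hend : pathNode I m = (m - I.card, I.card) := by
    simp only [pathNode, Fin.is_lt, true_and]
    rw [Finset.filter_not, Finset.filter_univ_mem, Finset.card_univ_sdiff, Fintype.card_fin]
  rw [hend] at hle
  refine ⟨s, hs, ?_, ?_⟩
  · refine le_trans ?_ hle.1
    have hJ : (Finset.univ \ J).card = m - I.card := by
      rw [Finset.card_univ_sdiff, Fintype.card_fin, hJI]
    have hsub : Finset.univ.filter (fun i : Fin m => (i : ℕ) < t ∧ i ∉ J) ⊆ Finset.univ \ J :=
      fun i hi => by simp_all
    exact (Finset.card_le_card hsub).trans hJ.le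
  · refine le_trans ?_ hle.2
    have hsub : Finset.univ.filter (fun i : Fin m => (i : ℕ) < t ∧ i ∈ J) ⊆ J :=
      fun i hi => by simp_all
    exact (Finset.card_le_card hsub).trans hJI.le

/-! ### The term order -/

section TermOrder

variable {m : ℕ} {L : Set (ℕ × ℕ)}

/-- The product of Plücker coordinates with exponent vector `e`. -/
noncomputable def pluckerMonomial (e : PluckerIndex m L →₀ ℕ) : MvPolynomial (Fin m × Fin m) ℂ :=
  e.prod fun I n => pluckerCoord I.1 ^ n

theorem pluckerPresentation_monomial (e : PluckerIndex m L →₀ ℕ) (a : ℂ) :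
    pluckerPresentation m L (MvPolynomial.monomial e a) = a • pluckerMonomial e := by
  rw [pluckerPresentation, MvPolynomial.aeval_monomial, Algebra.smul_def]
  rfl

theorem pluckerMonomial_add (e f : PluckerIndex m L →₀ ℕ) :
    pluckerMonomial (e + f) = pluckerMonomial e * pluckerMonomial f :=
  Finsupp.prod_add_index' (fun _ => pow_zero _) fun _ _ _ => pow_add _ _ _

theorem pluckerMonomial_single (I : PluckerIndex m L) :
    pluckerMonomial (Finsupp.single I 1) = pluckerCoord I.1 := by
  simp [pluckerMonomial]

theorem pluckerPresentation_eq_sum (p : MvPolynomial (PluckerIndex m L) ℂ) :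
    pluckerPresentation m L p = ∑ e ∈ p.support, p.coeff e • pluckerMonomial e := by
  conv_lhs => rw [p.as_sum, map_sum]
  simp_rw [pluckerPresentation_monomial]

/-- The additive extension to exponent vectors of a statistic on columns. -/
noncomputable def extendAdd {τ : Type} (w : Finset (Fin m) → (τ →₀ ℕ)) :
    (PluckerIndex m L →₀ ℕ) →+ (τ →₀ ℕ) :=
  Finsupp.liftAddHom fun I => multiplesHom _ (w I.1)

theorem extendAdd_apply {τ : Type} (w : Finset (Fin m) → (τ →₀ ℕ)) (e : PluckerIndex m L →₀ ℕ) :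
    extendAdd w e = ∑ I ∈ e.support, e I • w I.1 := by
  simp [extendAdd, Finsupp.sum]

theorem extendAdd_single {τ : Type} (w : Finset (Fin m) → (τ →₀ ℕ)) (I : PluckerIndex m L) :
    extendAdd w (Finsupp.single I 1) = w I.1 := by
  simp [extendAdd]

theorem monic_pluckerMonomial (e : PluckerIndex m L →₀ ℕ) :
    (diagonalOrder m).Monic (pluckerMonomial e) :=
  MonomialOrder.Monic.prod fun I _ => (monic_pluckerCoord I.1).pow

theorem degree_pluckerMonomial (e : PluckerIndex m L →₀ ℕ) :
    (diagonalOrder m).degree (pluckerMonomial e) = extendAdd diagExp e := by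
  rw [pluckerMonomial, Finsupp.prod, MonomialOrder.degree_prod
    (fun I _ => pow_ne_zero _ (monic_pluckerCoord I.1).ne_zero), extendAdd_apply]
  exact Finset.sum_congr rfl fun I _ => by rw [MonomialOrder.degree_pow, degree_pluckerCoord]

/-- The lexicographic order for some linear order of the variables. -/
noncomputable def someLexOrder (σ : Type) [Finite σ] : MonomialOrder.{0, 0} σ :=
  letI : LinearOrder σ := IsWellOrder.linearOrder WellOrderingRel
  MonomialOrder.lex

/-- The term order: leading exponents in the diagonal order are compared first, then the weights
`colWeight` lexicographically; remaining ties are broken arbitrarily. -/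
noncomputable def ncOrder (m : ℕ) (L : Set (ℕ × ℕ)) : MonomialOrder.{0, 0} (PluckerIndex m L) :=
  refineOrder (extendAdd diagExp) (diagonalOrder m)
    (refineOrder (extendAdd colWeight) (MonomialOrder.lex (σ := Fin m)) (someLexOrder _))

theorem ncOrder_lt_of_diagExp_lt {e f : PluckerIndex m L →₀ ℕ}
    (h : (diagonalOrder m).toSyn (extendAdd diagExp e) <
      (diagonalOrder m).toSyn (extendAdd diagExp f)) :
    (ncOrder m L).toSyn e < (ncOrder m L).toSyn f :=
  (refineOrder_lt_iff _ _ _ _ _).mpr (Or.inl h)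

theorem ncOrder_lt_of_colWeight_lt {e f : PluckerIndex m L →₀ ℕ}
    (h : extendAdd diagExp e = extendAdd diagExp f)
    (hw : (MonomialOrder.lex (σ := Fin m)).toSyn (extendAdd colWeight e) <
      (MonomialOrder.lex (σ := Fin m)).toSyn (extendAdd colWeight f)) :
    (ncOrder m L).toSyn e < (ncOrder m L).toSyn f :=
  (refineOrder_lt_iff _ _ _ _ _).mpr (Or.inr ⟨h, (refineOrder_lt_iff _ _ _ _ _).mpr (Or.inl hw)⟩)

/-! ### Non-crossing tableau monomials -/

theorem isNCTableau_iff (e : PluckerIndex m L →₀ ℕ) :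
    IsNCTableau e ↔ ∀ I J, e I ≠ 0 → e J ≠ 0 → NonCrossing I.1 J.1 := by
  simp only [IsNCTableau, ncComplex, Set.mem_ofPred_eq, Finset.mem_map, Finsupp.mem_support_iff,
    Function.Embedding.subtype_apply]
  constructor
  · exact fun h I J hI hJ => h.2 _ ⟨I, hI, rfl⟩ _ ⟨J, hJ, rfl⟩
  · intro h
    refine ⟨?_, ?_⟩
    · rintro _ ⟨I, -, rfl⟩
      exact I.2.2
    · rintro _ ⟨I, hI, rfl⟩ _ ⟨J, hJ, rfl⟩
      exact h I J hI hJ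

theorem IsNCTableau.of_le {e f : PluckerIndex m L →₀ ℕ} (he : IsNCTableau e)
    (h : ∀ I, f I ≠ 0 → e I ≠ 0) : IsNCTableau f := by
  rw [isNCTableau_iff] at he ⊢
  exact fun I J hI hJ => he I J (h I hI) (h J hJ)

theorem exists_crossAt_of_not_isNCTableau {e : PluckerIndex m L →₀ ℕ} (he : ¬ IsNCTableau e) :
    ∃ I J : PluckerIndex m L, ∃ a b, e I ≠ 0 ∧ e J ≠ 0 ∧ CrossAt I.1 J.1 a b := by
  rw [isNCTableau_iff] at he
  push Not at he
  obtain ⟨I, J, hI, hJ, hIJ⟩ := he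
  rw [nonCrossing_iff] at hIJ
  by_contra! hcon
  exact hIJ fun a b => ⟨hcon I J a b hI hJ, hcon J I a b hJ hI⟩

theorem extendAdd_diagExp_apply [Fintype (PluckerIndex m L)] (e : PluckerIndex m L →₀ ℕ)
    (i j : Fin m) :
    extendAdd diagExp e (i, j) = rowCount (fun I : PluckerIndex m L => I.1) e i j := by
  rw [extendAdd_apply, Finsupp.finsetSum_apply, rowCount, Finset.sum_filter]
  rw [Finset.sum_subset (Finset.subset_univ e.support)]
  · exact Finset.sum_congr rfl fun I _ => by simp [diagExp_apply]
  · intro I _ hI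
    simp [Finsupp.notMem_support_iff.mp hI]

/-- Distinct non-crossing tableaux have distinct leading exponents. -/
theorem extendAdd_diagExp_injOn :
    Set.InjOn (extendAdd diagExp) {e : PluckerIndex m L →₀ ℕ | IsNCTableau e} := by
  intro e he f hf hef
  have := Fintype.ofFinite (PluckerIndex m L)
  refine DFunLike.coe_injective (eq_of_nonCrossing_of_rowCount_eq
    (fun I : PluckerIndex m L => I.1) Subtype.val_injective (fun I => I.2.1)
    ((isNCTableau_iff e).mp he) ((isNCTableau_iff f).mp hf) fun s v hv => ?_)
  by_cases hs : s < m
  · have := DFunLike.congr_fun hef (⟨s, hs⟩, ⟨v, hv⟩)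
    rwa [extendAdd_diagExp_apply, extendAdd_diagExp_apply] at this
  · have : ∀ e : PluckerIndex m L → ℕ, rowCount (fun I : PluckerIndex m L => I.1) e s v = 0 := by
      intro e
      refine Finset.sum_eq_zero fun I hI => ?_
      simp only [Finset.mem_filter, Finset.mem_univ, true_and] at hI
      have h1 := card_finset_fin_le I.1
      rw [col_of_le I.1 (by omega)] at hI
      omega
    rw [this, this]

theorem linearIndependent_pluckerMonomial : LinearIndependent ℂ
    (fun e : {e : PluckerIndex m L →₀ ℕ // IsNCTableau e} => pluckerMonomial e.1) := by
  refine linearIndependent_of_degree_injective (diagonalOrder m) _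
    (fun e => (monic_pluckerMonomial e.1).ne_zero) fun e f hef => Subtype.ext ?_
  simp only [degree_pluckerMonomial] at hef
  exact extendAdd_diagExp_injOn e.2 f.2 hef

end TermOrder

/-! ### The initial ideal and the basis of the Plücker algebra -/

section InitialIdeal

variable {m : ℕ} {S : Set (ℕ × ℕ)}

/-- A monomial with a crossing is congruent to a combination of smaller ones: its uncrossing,
which has the same leading exponent and smaller weights, and monomials with smaller leading
exponents. -/
theorem pluckerMonomial_mem_span_of_not_isNCTableau
    {e : PluckerIndex m (partialStaircase S) →₀ ℕ} (he : ¬ IsNCTableau e) :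
    pluckerMonomial e ∈ Submodule.span ℂ
      (pluckerMonomial '' {f | (ncOrder m _).toSyn f < (ncOrder m _).toSyn e}) := by
  obtain ⟨I, J, a, b, hI, hJ, hcross⟩ := exists_crossAt_of_not_isNCTableau he
  obtain ⟨I', J', hcI', hcJ', hI', hJ'⟩ := hcross.exists_uncrossing
  have toIndex : ∀ (K : PluckerIndex m (partialStaircase S)) (A : Finset (Fin m)),
      A.card = K.1.card → A.Nonempty ∧ PathFits (partialStaircase S) A := fun K A hA =>
    ⟨Finset.card_pos.mp (hA ▸ Finset.card_pos.mpr K.2.1), K.2.2.of_card_eq hA⟩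
  have hIJ : I ≠ J := by
    rintro rfl
    exact lt_irrefl _ hcross.2.2.1
  obtain ⟨r, rfl⟩ : ∃ r, e = r + (Finsupp.single I 1 + Finsupp.single J 1) := by
    refine ⟨e - (Finsupp.single I 1 + Finsupp.single J 1), (tsub_add_cancel_of_le ?_).symm⟩
    intro K
    simp only [Finsupp.add_apply, Finsupp.single_apply]
    have h1 := Nat.pos_of_ne_zero hI
    have h2 := Nat.pos_of_ne_zero hJ
    split_ifs with h3 h4 h4
    · exact absurd (h3.trans h4.symm) hIJ
    · subst h3; omega
    · subst h4; omega
    · omega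
  let I₁ : PluckerIndex m (partialStaircase S) := ⟨I', toIndex J I' hcI'⟩
  let J₁ : PluckerIndex m (partialStaircase S) := ⟨J', toIndex I J' hcJ'⟩
  have hd : diagExp I.1 + diagExp J.1 = diagExp I' + diagExp J' := by
    ext ⟨i, j⟩
    simp only [Finsupp.add_apply, diagExp_apply, hI', hJ']
    split_ifs <;> simp_all
  have hdiff := pluckerCoord_mul_sub_mem_span hcI' hcJ' hd
  have hsmaller : pluckerMonomial (r + (Finsupp.single I₁ 1 + Finsupp.single J₁ 1)) ∈
      Submodule.span ℂ (pluckerMonomial '' {f | (ncOrder m _).toSyn f <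
        (ncOrder m _).toSyn (r + (Finsupp.single I 1 + Finsupp.single J 1))}) := by
    refine Submodule.subset_span ⟨_, ncOrder_lt_of_colWeight_lt ?_ ?_, rfl⟩
    · simp only [map_add, extendAdd_single]
      rw [hd]
    · simp only [map_add (extendAdd colWeight), extendAdd_single]
      rw [map_add, map_add _ (extendAdd colWeight r)]
      exact add_lt_add_right (hcross.colWeight_lt hI' hJ') _
  rw [← sub_add_cancel (pluckerMonomial (r + (Finsupp.single I 1 + Finsupp.single J 1)))
    (pluckerMonomial (r + (Finsupp.single I₁ 1 + Finsupp.single J₁ 1)))]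
  refine add_mem ?_ hsmaller
  rw [pluckerMonomial_add, pluckerMonomial_add, pluckerMonomial_add, pluckerMonomial_add,
    ← mul_sub]
  simp only [pluckerMonomial_single]
  have hmap := Submodule.mem_map_of_mem (f := LinearMap.mulLeft ℂ (pluckerMonomial r)) hdiff
  rw [Submodule.map_span] at hmap
  refine Submodule.span_mono ?_ hmap
  rintro _ ⟨_, ⟨A, B, hA, hB, hlt, rfl⟩, rfl⟩
  let A₁ : PluckerIndex m (partialStaircase S) := ⟨A, toIndex I A hA⟩
  let B₁ : PluckerIndex m (partialStaircase S) := ⟨B, toIndex J B hB⟩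
  refine ⟨r + (Finsupp.single A₁ 1 + Finsupp.single B₁ 1), ncOrder_lt_of_diagExp_lt ?_, ?_⟩
  · simp only [map_add (extendAdd diagExp), extendAdd_single]
    rw [map_add, map_add _ (extendAdd diagExp r)]
    exact add_lt_add_right hlt _
  · simp only [pluckerMonomial_add, pluckerMonomial_single]
    rfl

/-- Reduction to normal form: the non-crossing tableau monomials below a given monomial in the term
order suffice to express it. -/
theorem pluckerMonomial_mem_span_isNCTableau
    (e : PluckerIndex m (partialStaircase S) →₀ ℕ) :
    pluckerMonomial e ∈ Submodule.span ℂ (pluckerMonomial ''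
      {f | IsNCTableau f ∧ (ncOrder m _).toSyn f ≤ (ncOrder m _).toSyn e}) := by
  induction h : (ncOrder m (partialStaircase S)).toSyn e using WellFoundedLT.induction
    generalizing e with
  | _ x ih =>
    subst h
    by_cases he : IsNCTableau e
    · exact Submodule.subset_span ⟨e, ⟨he, le_rfl⟩, rfl⟩
    · refine Submodule.span_le.mpr ?_ (pluckerMonomial_mem_span_of_not_isNCTableau he)
      rintro _ ⟨f, hf, rfl⟩
      refine Submodule.span_mono (Set.image_mono ?_) (ih _ hf f rfl)
      exact fun g hg => ⟨hg.1, hg.2.trans (le_of_lt hf)⟩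

/-- The leading exponents of the relations are those of the crossing tableaux. -/
theorem exists_mem_pluckerIdeal_degree_iff
    (e : PluckerIndex m (partialStaircase S) →₀ ℕ) :
    (∃ f ∈ pluckerIdeal m (partialStaircase S), f ≠ 0 ∧ (ncOrder m _).degree f = e) ↔
      ¬ IsNCTableau e := by
  constructor
  · -- such a relation would express a non-crossing monomial by smaller ones, hence, after reduction,
    -- by smaller non-crossing ones
    rintro ⟨f, hf, hf0, rfl⟩ hnc
    set d := (ncOrder m (partialStaircase S)).degree f with hd
    have hcoeff : f.coeff d ≠ 0 := (ncOrder m _).coeff_degree_ne_zero_iff.mpr hf0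
    refine linearIndependent_pluckerMonomial.notMem_span_image
      (s := {g | (ncOrder m _).toSyn g.1 < (ncOrder m _).toSyn d}) (x := ⟨d, hnc⟩)
      (by simp) ?_
    have hsum : f.coeff d • pluckerMonomial d +
        ∑ g ∈ f.support.erase d, f.coeff g • pluckerMonomial g = 0 := by
      rw [Finset.add_sum_erase f.support (fun g => f.coeff g • pluckerMonomial g)
        (MvPolynomial.mem_support_iff.mpr hcoeff), ← pluckerPresentation_eq_sum]
      exact hf
    refine (Submodule.smul_mem_iff _ hcoeff).mp ?_
    rw [eq_neg_of_add_eq_zero_left hsum]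
    refine neg_mem (sum_mem fun g hg => Submodule.smul_mem _ _ ?_)
    obtain ⟨hgd, hg⟩ := Finset.mem_erase.mp hg
    have hlt : (ncOrder m _).toSyn g < (ncOrder m _).toSyn d :=
      lt_of_le_of_ne ((ncOrder m _).le_degree hg) fun h => hgd ((ncOrder m _).toSyn.injective h)
    refine Submodule.span_mono ?_ (pluckerMonomial_mem_span_isNCTableau g)
    rintro _ ⟨g', ⟨hg', hle⟩, rfl⟩
    exact ⟨⟨g', hg'⟩, hle.trans_lt hlt, rfl⟩
  · intro he
    obtain ⟨l, hl, hle⟩ := (Finsupp.mem_span_image_iff_linearCombination ℂ).mp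
      (pluckerMonomial_mem_span_of_not_isNCTableau he)
    let p : MvPolynomial (PluckerIndex m (partialStaircase S)) ℂ :=
      ∑ g ∈ l.support, MvPolynomial.monomial g (l g)
    have hp : ∀ g ∈ p.support, (ncOrder m _).toSyn g < (ncOrder m _).toSyn e := by
      intro g hg
      obtain ⟨g', hg', hgg'⟩ := Finset.mem_biUnion.mp (MvPolynomial.support_sum hg)
      rw [Finset.mem_singleton.mp (MvPolynomial.support_monomial_subset hgg')]
      exact (Finsupp.mem_supported ℂ l).mp hl hg'
    have hcoeff : (MvPolynomial.monomial e 1 - p).coeff e = 1 := by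
      have : p.coeff e = 0 := MvPolynomial.notMem_support_iff.mp fun h => lt_irrefl _ (hp e h)
      simp [this]
    refine ⟨MvPolynomial.monomial e 1 - p, ?_, ?_, ?_⟩
    · rw [pluckerIdeal, RingHom.mem_ker, map_sub, pluckerPresentation_monomial, one_smul,
        map_sum, sub_eq_zero]
      simp_rw [pluckerPresentation_monomial]
      rw [← hle, Finsupp.linearCombination_apply]
      rfl
    · intro h
      simp [h] at hcoeff
    · refine (degree_eq_and_monic _ hcoeff fun g hg => ?_).1
      rcases Finset.mem_union.mp (MvPolynomial.support_sub _ _ _ hg) with h | h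
      · rw [Finset.mem_singleton.mp (MvPolynomial.support_monomial_subset h)]
      · exact (hp g h).le

theorem isStandardMonomial_iff
    (e : PluckerIndex m (partialStaircase S) →₀ ℕ) :
    IsStandardMonomial (ncOrder m _) (pluckerIdeal m (partialStaircase S)) e ↔ IsNCTableau e := by
  have himage : initialIdeal (ncOrder m _) (pluckerIdeal m (partialStaircase S)) =
      Ideal.span ((fun e => MvPolynomial.monomial e (1 : ℂ)) '' {e | ¬ IsNCTableau e}) := by
    rw [initialIdeal]
    congr 1
    ext g
    simp only [Set.mem_ofPred_eq, Set.mem_image, ← exists_mem_pluckerIdeal_degree_iff]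
    constructor
    · rintro ⟨f, hf, hf0, rfl⟩
      exact ⟨_, ⟨f, hf, hf0, rfl⟩, rfl⟩
    · rintro ⟨_, ⟨f, hf, hf0, rfl⟩, rfl⟩
      exact ⟨f, hf, hf0, rfl⟩
  rw [IsStandardMonomial, himage, MvPolynomial.mem_ideal_span_monomial_image, not_iff_comm]
  constructor
  · intro he d hd
    rw [Finset.mem_singleton.mp (MvPolynomial.support_monomial_subset hd)]
    exact ⟨e, he, le_rfl⟩
  · intro h he
    obtain ⟨d, hd, hde⟩ := h e (by simp)
    exact hd (he.of_le fun I hI => (Nat.pos_of_ne_zero hI |>.trans_le (hde I)).ne')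

theorem isSquarefreeMonomialIdeal_initialIdeal :
    IsSquarefreeMonomialIdeal
      (initialIdeal (ncOrder m _) (pluckerIdeal m (partialStaircase S))) := by
  refine ⟨{e | (∀ I, e I ≤ 1) ∧ ¬ IsNCTableau e}, fun e he => he.1, le_antisymm ?_ ?_⟩
  · refine Ideal.span_le.mpr ?_
    rintro _ ⟨f, hf, hf0, rfl⟩
    have hnc := (exists_mem_pluckerIdeal_degree_iff _).mp ⟨f, hf, hf0, rfl⟩
    refine MvPolynomial.mem_ideal_span_monomial_image.mpr fun d hd => ?_
    rw [Finset.mem_singleton.mp (MvPolynomial.support_monomial_subset hd)]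
    -- the squarefree part of the leading monomial
    refine ⟨Finsupp.mapRange (fun n => min n 1) rfl ((ncOrder m _).degree f),
      ⟨fun I => by simp, fun h => hnc (h.of_le fun I hI => ?_)⟩, fun I => by simp⟩
    rw [Finsupp.mapRange_apply]
    omega
  · refine Ideal.span_le.mpr ?_
    rintro _ ⟨e, he, rfl⟩
    by_contra h
    exact he.2 ((isStandardMonomial_iff e).mp h)

theorem pluckerCoord_empty : pluckerCoord (∅ : Finset (Fin m)) = 1 := by
  rw [pluckerCoord]
  have : IsEmpty (Fin (∅ : Finset (Fin m)).card) := by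
    rw [Finset.card_empty]
    infer_instance
  exact Matrix.det_isEmpty

theorem pluckerAlgebra_eq_range (L : Set (ℕ × ℕ)) :
    pluckerAlgebra m L = (pluckerPresentation m L).range := by
  refine le_antisymm (Algebra.adjoin_le ?_) ?_
  · rintro _ ⟨I, hI, rfl⟩
    rcases I.eq_empty_or_nonempty with rfl | hne
    · rw [pluckerCoord_empty]
      exact one_mem _
    · exact ⟨MvPolynomial.X ⟨I, hne, hI⟩, MvPolynomial.aeval_X _ _⟩
  · rw [pluckerPresentation, ← Algebra.adjoin_range_eq_range_aeval]
    refine Algebra.adjoin_mono ?_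
    rintro _ ⟨I, rfl⟩
    exact ⟨I.1, I.2.2, rfl⟩

theorem span_pluckerMonomial_eq :
    Submodule.span ℂ (Set.range fun e : {e : PluckerIndex m (partialStaircase S) →₀ ℕ //
      IsNCTableau e} => pluckerMonomial e.1) =
      Subalgebra.toSubmodule (pluckerAlgebra m (partialStaircase S)) := by
  rw [pluckerAlgebra_eq_range]
  refine le_antisymm (Submodule.span_le.mpr ?_) ?_
  · rintro _ ⟨e, rfl⟩
    exact ⟨MvPolynomial.monomial e.1 1, by
      simpa using pluckerPresentation_monomial e.1 1⟩
  · rintro _ ⟨p, rfl⟩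
    change pluckerPresentation _ _ p ∈ _
    rw [pluckerPresentation_eq_sum]
    refine sum_mem fun e _ => Submodule.smul_mem _ _ ?_
    refine Submodule.span_mono ?_ (pluckerMonomial_mem_span_isNCTableau e)
    rintro _ ⟨f, hf, rfl⟩
    exact ⟨⟨f, hf.1⟩, rfl⟩

/-- The basis of the Plücker algebra formed by the non-crossing tableau monomials. -/
noncomputable def ncBasis :
    Module.Basis {e : PluckerIndex m (partialStaircase S) →₀ ℕ // IsNCTableau e} ℂ
      (pluckerAlgebra m (partialStaircase S)) :=
  (Module.Basis.span linearIndependent_pluckerMonomial).map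
    (LinearEquiv.ofEq _ _ span_pluckerMonomial_eq)

theorem ncBasis_apply
    (e : {e : PluckerIndex m (partialStaircase S) →₀ ℕ // IsNCTableau e}) :
    (ncBasis e : MvPolynomial (Fin m × Fin m) ℂ) = pluckerMonomial e.1 := by
  rw [ncBasis, Module.Basis.map_apply]
  exact congrArg Subtype.val (Module.Basis.span_apply linearIndependent_pluckerMonomial e)

end InitialIdeal

end NonCrossingTableaux

theorem mainTheorem7 (m : ℕ) (S : Set (ℕ × ℕ))
    (hS : S ⊆ NonCrossingTableaux.staircaseSinks m) :
    ∃ ord : MonomialOrder.{0, 0}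
        (NonCrossingTableaux.PluckerIndex m (NonCrossingTableaux.partialStaircase S)),
      (∀ e : NonCrossingTableaux.PluckerIndex m (NonCrossingTableaux.partialStaircase S) →₀ ℕ,
        NonCrossingTableaux.IsStandardMonomial ord
            (NonCrossingTableaux.pluckerIdeal m (NonCrossingTableaux.partialStaircase S)) e ↔
          NonCrossingTableaux.IsNCTableau e) ∧
      NonCrossingTableaux.IsSquarefreeMonomialIdeal
        (NonCrossingTableaux.initialIdeal ord
          (NonCrossingTableaux.pluckerIdeal m (NonCrossingTableaux.partialStaircase S))) ∧
      ∃ b : Module.Basis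
          {e : NonCrossingTableaux.PluckerIndex m (NonCrossingTableaux.partialStaircase S) →₀ ℕ //
            NonCrossingTableaux.IsNCTableau e} ℂ
          (NonCrossingTableaux.pluckerAlgebra m (NonCrossingTableaux.partialStaircase S)),
        ∀ e, (b e : MvPolynomial (Fin m × Fin m) ℂ) =
          e.1.prod (fun I n => NonCrossingTableaux.pluckerCoord I.1 ^ n) := by
  exact ⟨NonCrossingTableaux.ncOrder m _, NonCrossingTableaux.isStandardMonomial_iff,
    NonCrossingTableaux.isSquarefreeMonomialIdeal_initialIdeal,
    NonCrossingTableaux.ncBasis, NonCrossingTableaux.ncBasis_apply⟩
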